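/- Let $L>0$ and let $E,I:[0,L]\to(0,\infty)$ be such that $EI$ is measurable and $0<C_1\le E(x)I(x)\le C_2$ for all $x\in(0,L)$, with constants $C_1,C_2$. Let $V=H^2_0(0,L)=\{v\in H^2(0,L): v(0)=v'(0)=v(L)=v'(L)=0\}$, and for a measurable function $k$ on $(0,L)$ with positive lower and upper bounds consider the buckling eigenvalue problem: find $P\in\mathbb{R}$ and $u\in V\setminus\{0\}$ such that $$\int_0^L k\,u''v''\,dx = P\int_0^L u'v'\,dx\qquad\text{for all } v\in V. \tag{$*$}$$ Let $0=x_1<x_2<\dots<x_{N+1}=L$ be a partition into elements $K_j=[x_j,x_{j+1}]$, let $\kappa_j=\inf_{x\in K_j}E(x)I(x)$ (the minimum, if it is attained), and let $\kappa$ be the piecewise constant function on $[0,L]$ equal to $\kappa_j$ on $K_j$, $j=1,\dots,N$ (its values at the nodes are irrelevant). Then the eigenvalues of $(*)$ with $k=EI$ can be listed as an infinite nondecreasing sequence $P_1\le P_2\le\cdots$, and those of $(*)$ with $k=\kappa$ (the auxiliary problem) as an infinite nondecreasing sequence $\widetilde P_1\le\widetilde P_2\le\cdots$, where each list contains all eigenvalues,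 each repeated according to its (finite) multiplicity, and $$\widetilde P_i\le P_i\qquad\text{for all } i=1,2,\dots.$$ -/

import Mathlib

open MeasureTheory Set
open scoped ContDiff

noncomputable section

namespace Beam

/-- The real Hilbert space `L²(0, L)`. -/
abbrev L2 (L : ℝ) : Type := Lp ℝ 2 (volume.restrict (Ioo (0 : ℝ) L))

/-- Test functions on `(0, L)`: smooth functions with compact support inside `(0, L)`. -/
structure IsTest (L : ℝ) (φ : ℝ → ℝ) : Prop where
  smooth : ContDiff ℝ ∞ φ
  compact : HasCompactSupport φ
  inside : tsupport φ ⊆ Ioo 0 L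

/-- `g ∈ L²(0, L)` is the generalized (weak) derivative of `u ∈ L²(0, L)` on `(0, L)`. -/
def HasWeakDeriv (L : ℝ) (u g : L2 L) : Prop :=
  ∀ φ : ℝ → ℝ, IsTest L φ →
    ∫ x in Ioo 0 L, u x * deriv φ x = -∫ x in Ioo 0 L, g x * φ x

theorem integrable_mul_of_cont {L : ℝ} (f : L2 L) {ψ : ℝ → ℝ} (hc : Continuous ψ)
    (hs : HasCompactSupport ψ) :
    Integrable (fun x => f x * ψ x) (volume.restrict (Ioo 0 L)) :=
  (Lp.memLp f).integrable_mul ((hc.memLp_of_hasCompactSupport (p := 2) (μ := volume) hs).restrict _)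

theorem IsTest.integrable {L : ℝ} {φ : ℝ → ℝ} (h : IsTest L φ) (f : L2 L) :
    Integrable (fun x => f x * φ x) (volume.restrict (Ioo 0 L)) :=
  integrable_mul_of_cont f h.smooth.continuous h.compact

theorem IsTest.integrable_deriv {L : ℝ} {φ : ℝ → ℝ} (h : IsTest L φ) (f : L2 L) :
    Integrable (fun x => f x * deriv φ x) (volume.restrict (Ioo 0 L)) :=
  integrable_mul_of_cont f (h.smooth.continuous_deriv (by simp)) h.compact.deriv

theorem HasWeakDeriv.zero (L : ℝ) : HasWeakDeriv L 0 0 := by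
  intro φ _
  have e : ∀ ψ : ℝ → ℝ, ∫ x in Ioo 0 L, (0 : L2 L) x * ψ x = 0 := by
    intro ψ
    rw [integral_eq_zero_of_ae]
    filter_upwards [Lp.coeFn_zero ℝ 2 (volume.restrict (Ioo (0 : ℝ) L))] with x hx
    rw [hx, Pi.zero_apply, zero_mul]
  rw [e, e, neg_zero]

theorem HasWeakDeriv.add {L : ℝ} {u v g h : L2 L} (hu : HasWeakDeriv L u g)
    (hv : HasWeakDeriv L v h) : HasWeakDeriv L (u + v) (g + h) := by
  intro φ hφ
  have e : ∀ (p q : L2 L) (ψ : ℝ → ℝ),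
      ∫ x in Ioo 0 L, (p + q : L2 L) x * ψ x = ∫ x in Ioo 0 L, (p x * ψ x + q x * ψ x) := by
    intro p q ψ
    refine integral_congr_ae ?_
    filter_upwards [Lp.coeFn_add p q] with x hx
    rw [hx, Pi.add_apply, add_mul]
  rw [e, e, integral_add (hφ.integrable_deriv u) (hφ.integrable_deriv v),
    integral_add (hφ.integrable g) (hφ.integrable h), hu φ hφ, hv φ hφ]
  ring

theorem HasWeakDeriv.smul {L : ℝ} {u g : L2 L} (c : ℝ) (hu : HasWeakDeriv L u g) :
    HasWeakDeriv L (c • u) (c • g) := by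
  intro φ hφ
  have e : ∀ (p : L2 L) (ψ : ℝ → ℝ),
      ∫ x in Ioo 0 L, (c • p : L2 L) x * ψ x = c * ∫ x in Ioo 0 L, p x * ψ x := by
    intro p ψ
    rw [← integral_const_mul]
    refine integral_congr_ae ?_
    filter_upwards [Lp.coeFn_smul c p] with x hx
    rw [hx, Pi.smul_apply, smul_eq_mul, mul_assoc]
  rw [e, e, hu φ hφ]
  ring

/-- Weak derivatives are unique, so that `weakDeriv` below does not depend on any choice. -/
theorem HasWeakDeriv.unique {L : ℝ} {u g h : L2 L} (hg : HasWeakDeriv L u g)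
    (hh : HasWeakDeriv L u h) : g = h := by
  have key : ∀ᵐ x, x ∈ Ioo 0 L → (g x - h x) = 0 := by
    refine isOpen_Ioo.ae_eq_zero_of_integral_contDiff_smul_eq_zero
      (f := fun x => g x - h x) ?_ ?_
    · have hi : ∀ p : L2 L, IntegrableOn p (Ioo 0 L) volume := fun p =>
        (Lp.memLp p).integrable (by norm_num)
      exact ((hi g).sub (hi h)).locallyIntegrableOn
    · intro φ h1 h2 h3
      have hφ : IsTest L φ := ⟨h1, h2, h3⟩
      have hz : ∫ x in Ioo 0 L, (g x * φ x - h x * φ x) = 0 := by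
        rw [integral_sub (hφ.integrable g) (hφ.integrable h)]
        linarith [hg φ hφ, hh φ hφ]
      rw [← setIntegral_eq_integral_of_forall_compl_eq_zero (s := Ioo 0 L)]
      · refine Eq.trans ?_ hz
        refine integral_congr_ae (Filter.Eventually.of_forall fun x => ?_)
        simp only [smul_eq_mul]
        ring
      · intro x hx
        have : φ x = 0 := image_eq_zero_of_notMem_tsupport fun hx' => hx (h3 hx')
        simp [this]
  refine Lp.ext ?_
  filter_upwards [(ae_restrict_iff' measurableSet_Ioo).2 key] with x hx
  linarith

open Classical in
/-- The weak derivative of `u` in `L²(0, L)` (with the dummy value `0` if there is none). -/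
def weakDeriv (L : ℝ) (u : L2 L) : L2 L :=
  if h : ∃ g, HasWeakDeriv L u g then h.choose else 0

theorem HasWeakDeriv.weakDeriv_eq {L : ℝ} {u g : L2 L} (h : HasWeakDeriv L u g) :
    weakDeriv L u = g := by
  have hex : ∃ g, HasWeakDeriv L u g := ⟨g, h⟩
  rw [weakDeriv, dif_pos hex]
  exact hex.choose_spec.unique h

/-- `w` is a `C¹([0, L])` function with `w(0) = w'(0) = w(L) = w'(L) = 0` (one-sided derivatives
at the end points). -/
structure IsClamped (L : ℝ) (w : ℝ → ℝ) : Prop where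
  contDiffOn : ContDiffOn ℝ 1 w (Icc 0 L)
  left : w 0 = 0
  right : w L = 0
  deriv_left : derivWithin w (Icc 0 L) 0 = 0
  deriv_right : derivWithin w (Icc 0 L) L = 0

/-- `V = H²₀(0, L)`: the functions in `L²(0, L)` with weak first and second derivatives in
`L²(0, L)` whose `C¹([0, L])` representative satisfies the clamped boundary conditions. -/
def H20 (L : ℝ) : Submodule ℝ (L2 L) where
  carrier := {u | (∃ g₁ g₂ : L2 L, HasWeakDeriv L u g₁ ∧ HasWeakDeriv L g₁ g₂) ∧
    ∃ w : ℝ → ℝ, IsClamped L w ∧ u =ᵐ[volume.restrict (Ioo 0 L)] w}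
  zero_mem' :=
    ⟨⟨0, 0, .zero L, .zero L⟩, fun _ => 0, ⟨contDiffOn_const, rfl, rfl, by simp, by simp⟩,
      Lp.coeFn_zero _ _ _⟩
  add_mem' := by
    rintro u v ⟨⟨g₁, g₂, h₁, h₂⟩, w, hw, huw⟩ ⟨⟨k₁, k₂, i₁, i₂⟩, z, hz, hvz⟩
    refine ⟨⟨g₁ + k₁, g₂ + k₂, h₁.add i₁, h₂.add i₂⟩, w + z,
      ⟨hw.contDiffOn.add hz.contDiffOn, by simp [hw.left, hz.left],
        by simp [hw.right, hz.right], ?_, ?_⟩, (Lp.coeFn_add u v).trans (huw.add hvz)⟩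
    · by_cases h : (0 : ℝ) ∈ Icc 0 L
      · rw [derivWithin_add (hw.contDiffOn.differentiableOn (by simp) _ h)
          (hz.contDiffOn.differentiableOn (by simp) _ h), hw.deriv_left, hz.deriv_left, add_zero]
      · have : Icc 0 L = ∅ := by
          rw [Icc_eq_empty_iff]; exact fun h' => h ⟨le_rfl, h'⟩
        rw [this]; exact derivWithin_zero_of_not_accPt (by simp [AccPt])
    · by_cases h : L ∈ Icc 0 L
      · rw [derivWithin_add (hw.contDiffOn.differentiableOn (by simp) _ h)
          (hz.contDiffOn.differentiableOn (by simp) _ h), hw.deriv_right, hz.deriv_right, add_zero]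
      · have : Icc 0 L = ∅ := by
          rw [Icc_eq_empty_iff]; exact fun h' => h ⟨h', le_rfl⟩
        rw [this]; exact derivWithin_zero_of_not_accPt (by simp [AccPt])
  smul_mem' := by
    rintro c u ⟨⟨g₁, g₂, h₁, h₂⟩, w, hw, huw⟩
    refine ⟨⟨c • g₁, c • g₂, h₁.smul c, h₂.smul c⟩, c • w,
      ⟨contDiffOn_const.smul hw.contDiffOn, by simp [hw.left], by simp [hw.right], ?_, ?_⟩,
      (Lp.coeFn_smul c u).trans (huw.const_smul c)⟩
    · rw [derivWithin_const_smul_field, hw.deriv_left, smul_zero]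
    · rw [derivWithin_const_smul_field, hw.deriv_right, smul_zero]

/-- The form `∫₀ᴸ k u'' v'' dx`, for a bending stiffness `k`. -/
def bendingForm (L : ℝ) (k : ℝ → ℝ) (u v : L2 L) : ℝ :=
  ∫ x in Ioo 0 L, k x * weakDeriv L (weakDeriv L u) x * weakDeriv L (weakDeriv L v) x

/-- The form `b(u, v) = ∫₀ᴸ u' v' dx`. -/
def geometricForm (L : ℝ) (u v : L2 L) : ℝ :=
  ∫ x in Ioo 0 L, weakDeriv L u x * weakDeriv L v x

/-- `u` is an eigenfunction, for the eigenvalue `P`, of the weak buckling problem of the clamped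
beam of length `L` with bending stiffness `k`. -/
structure IsEigenfunction (L : ℝ) (k : ℝ → ℝ) (P : ℝ) (u : L2 L) : Prop where
  mem : u ∈ H20 L
  ne_zero : u ≠ 0
  weak_form : ∀ v ∈ H20 L, bendingForm L k u v = P * geometricForm L u v

/-- The linear space spanned by the eigenfunctions for `P`; it is `⊥` if `P` is not an
eigenvalue, and its dimension is the multiplicity of `P`. -/
def eigenspace (L : ℝ) (k : ℝ → ℝ) (P : ℝ) : Submodule ℝ (L2 L) :=
  Submodule.span ℝ {u | IsEigenfunction L k P u}

/-- `P 0 ≤ P 1 ≤ P 2 ≤ ⋯` is the list of all eigenvalues of the buckling problem in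
nondecreasing order, each repeated as many times as its multiplicity. -/
structure IsEigenvalueSequence (L : ℝ) (k : ℝ → ℝ) (P : ℕ → ℝ) : Prop where
  mono : Monotone P
  multiplicity : ∀ r : ℝ,
    {i : ℕ | P i = r}.encard = Cardinal.toENat (Module.rank ℝ (eigenspace L k r))

/-- The minimal value (infimum) of `k` over the element `K_j = [x_j, x_{j+1}]`. -/
def elementMin {N : ℕ} (x : Fin (N + 1) → ℝ) (k : ℝ → ℝ) (j : Fin N) : ℝ :=
  sInf (k '' Icc (x j.castSucc) (x j.succ))

/-- The piecewise constant function equal to `elementMin x k j` on the `j`-th element, for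
every `j`. At an interior node, which is shared by two elements, it takes the value of the element
to the right; the values at the nodes do not influence any integral. -/
def piecewiseMin {N : ℕ} (x : Fin (N + 1) → ℝ) (k : ℝ → ℝ) (t : ℝ) : ℝ :=
  ∑ j : Fin N, (Ico (x j.castSucc) (x j.succ)).indicator (fun _ => elementMin x k j) t

end Beam

end

/-! ### Enumeration of a locally finite family of multiplicities -/

/-! For `u` in H²₀ put `f = √k u''`. Then `u'` and `u` are the first and second primitives of
`f/√k`; the clamping at `0` is automatic and the clamping at `L` is the vanishing of two continuous
functionals (`mem_H20_iff`). So `f` ranges over a closed subspace of L² of finite codimension, the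
bending form becomes `⟪f, g⟫`, and the geometric form becomes `⟪K f, K g⟫` for the map `K : √k u'' ↦
u'` (`IsStiffness.slope`), which is injective, and compact by Arzelà–Ascoli.

The buckling problem is thus `f = r K*K f`. The spectral theorem makes the span of all eigenspaces
dense, and compactness makes the span of those with `r ≤ c` finite dimensional. Multiplicities are
therefore locally finite with infinite support, and such a family can be enumerated
(`exists_isPencilSequence`).

The inequality is a Courant–Fischer dimension count (`IsPencilSequence.le_of_norm_le`).
Multiplication by `√κ/√k` keeps `u`, hence `‖u'‖`, and does not increase the norm since `κ ≤ k`. The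
eigenspaces for `P 0, …, P i` span a space of dimension at least `i + 1` on which `‖f‖² ≤ P i ‖K
f‖²`. The eigenvalues of the `κ`-problem below `P' i` span at most `i` dimensions, and `P' i ‖K' f‖²
≤ ‖f‖²` on the orthogonal complement. Some nonzero `f` satisfies both bounds. -/

theorem exists_monotone_encard_fiber_eq (m : ℝ → ℕ) (hpos : ∀ r ≤ 0, m r = 0)
    (hfin : ∀ c : ℝ, {s | s ≤ c ∧ m s ≠ 0}.Finite) (hinf : {s | m s ≠ 0}.Infinite) :
    ∃ P : ℕ → ℝ, Monotone P ∧ ∀ r, {i | P i = r}.encard = m r := by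
  classical
  -- The counting function with multiplicity. The enumeration is its generalized inverse `i ↦ sInf
  -- {c | i < cnt c}`.
  let cnt : ℝ → ℕ := fun c => ∑ s ∈ (hfin c).toFinset, m s
  have hmono : Monotone cnt := fun a b hab => by
    refine Finset.sum_le_sum_of_subset fun s hs => ?_
    simp only [Finite.mem_toFinset, mem_ofPred_eq] at hs ⊢
    exact ⟨hs.1.trans hab, hs.2⟩
  have hzero : ∀ c ≤ 0, cnt c = 0 := fun c hc => by
    refine Finset.sum_eq_zero fun s hs => hpos s ?_
    simp only [Finite.mem_toFinset, mem_ofPred_eq] at hs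
    exact hs.1.trans hc
  have hub : ∀ i, ∃ c, i < cnt c := fun i => by
    obtain ⟨t, ht, hcard⟩ := hinf.exists_subset_card_eq (i + 1)
    obtain ⟨c, hc⟩ := t.finite_toSet.bddAbove
    refine ⟨c, ?_⟩
    calc i < ∑ s ∈ t, 1 := by simp [hcard]
      _ ≤ ∑ s ∈ t, m s := Finset.sum_le_sum fun s hs => Nat.one_le_iff_ne_zero.2 (ht hs)
      _ ≤ cnt c := Finset.sum_le_sum_of_subset fun s hs => by
        simp only [Finite.mem_toFinset, mem_ofPred_eq]
        exact ⟨hc hs, ht hs⟩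
  have hbdd : ∀ i, BddBelow {c | i < cnt c} := fun i => ⟨0, fun c hc => by
    by_contra! h
    have := hzero c h.le
    simp only [mem_ofPred_eq] at hc
    omega⟩
  have hright : ∀ r, ∃ r' > r, cnt r' = cnt r := fun r => by
    have hf : ({s | s ≤ r + 1 ∧ m s ≠ 0} ∩ Ioi r).Finite := (hfin (r + 1)).inter_of_left _
    obtain ⟨r', hr, hr'⟩ : ∃ r' > r, r' ≤ r + 1 ∧ ∀ s, r < s → s ≤ r' → m s = 0 := by
      rcases hf.toFinset.eq_empty_or_nonempty with he | hne
      · refine ⟨r + 1, by simp, le_rfl, fun s h1 h2 => ?_⟩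
        by_contra h
        have : s ∈ hf.toFinset := by simp [h1, h2, h]
        simp [he] at this
      · have hm := hf.toFinset.min'_mem hne
        set q := hf.toFinset.min' hne
        simp only [Finite.mem_toFinset, mem_inter_iff, mem_ofPred_eq, mem_Ioi] at hm
        refine ⟨(r + q) / 2, by linarith [hm.2], by linarith [hm.1.1], fun s h1 h2 => ?_⟩
        by_contra h
        have : s ∈ hf.toFinset := by
          simp only [Finite.mem_toFinset, mem_inter_iff, mem_ofPred_eq, mem_Ioi]
          exact ⟨⟨by linarith [hm.1.1], h⟩, h1⟩
        have := hf.toFinset.min'_le s this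
        linarith
    refine ⟨r', hr, Finset.sum_congr ?_ fun _ _ => rfl⟩
    ext s
    simp only [Finite.mem_toFinset, mem_ofPred_eq]
    exact ⟨fun h => ⟨by by_contra! h'; exact h.2 (hr'.2 s h' h.1), h.2⟩,
      fun h => ⟨h.1.trans hr.le, h.2⟩⟩
  -- Constancy of `cnt` just to the right of each point makes the infimum a minimum, so the two
  -- functions form a Galois connection.
  have hle : ∀ i r, sInf {c | i < cnt c} ≤ r ↔ i < cnt r := fun i r => by
    refine ⟨fun h => ?_, fun h => csInf_le (hbdd i) h⟩
    obtain ⟨r', hr, he⟩ := hright r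
    obtain ⟨c, hc, hcr⟩ := exists_lt_of_csInf_lt (hub i) (h.trans_lt hr)
    rw [← he]
    exact lt_of_lt_of_le hc (hmono hcr.le)
  have hleft : ∀ r, ∃ r' < r, ∀ s, r' ≤ s → s < r → cnt s + m r = cnt r := fun r => by
    have hf : ({s | s ≤ r ∧ m s ≠ 0} ∩ Iio r).Finite := (hfin r).inter_of_left _
    obtain ⟨r', hr, hr'⟩ : ∃ r' < r, ∀ s, r' < s → s < r → m s = 0 := by
      rcases hf.toFinset.eq_empty_or_nonempty with he | hne
      · refine ⟨r - 1, by simp, fun s h1 h2 => ?_⟩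
        by_contra h
        have : s ∈ hf.toFinset := by simp [h2, h2.le, h]
        simp [he] at this
      · have hm := hf.toFinset.max'_mem hne
        set q := hf.toFinset.max' hne
        simp only [Finite.mem_toFinset, mem_inter_iff, mem_ofPred_eq, mem_Iio] at hm
        refine ⟨q, hm.2, fun s h1 h2 => ?_⟩
        by_contra h
        have : s ∈ hf.toFinset := by
          simp only [Finite.mem_toFinset, mem_inter_iff, mem_ofPred_eq, mem_Iio]
          exact ⟨⟨h2.le, h⟩, h2⟩
        have := hf.toFinset.le_max' s this
        linarith
    refine ⟨r', hr, fun s h1 h2 => ?_⟩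
    have hins : cnt r = ∑ s ∈ insert r (hfin s).toFinset, m s := by
      refine Finset.sum_subset (fun t ht => ?_) fun t ht ht' => ?_
      · simp only [Finite.mem_toFinset, mem_ofPred_eq, Finset.mem_insert] at ht ⊢
        rcases ht.1.eq_or_lt with h | h
        · exact Or.inl h
        · refine Or.inr ⟨?_, ht.2⟩
          by_contra! h'
          exact ht.2 (hr' t (h1.trans_lt h') h)
      · simp only [Finite.mem_toFinset, mem_ofPred_eq, Finset.mem_insert, not_and, not_not] at ht ht'
        refine ht' ?_
        rcases ht with rfl | h
        · exact le_rfl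
        · exact h.1.trans h2.le
    rw [hins, Finset.sum_insert (by simp [h2]), add_comm]
  refine ⟨fun i => sInf {c | i < cnt c}, fun i j hij => ?_, fun r => ?_⟩
  · exact (hle i _).2 (lt_of_le_of_lt hij ((hle j _).1 le_rfl))
  · obtain ⟨r', hr', hs⟩ := hleft r
    -- The fiber over `r` is the block of indices by which `cnt` jumps at `r`, and `hleft` says that
    -- the jump is `m r`.
    have : {i | sInf {c | i < cnt c} = r} = (Finset.Ico (cnt r') (cnt r) : Finset ℕ) := by
      ext i
      simp only [mem_ofPred_eq, Finset.coe_Ico, mem_Ico]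
      refine ⟨fun h => ⟨?_, (hle i r).1 h.le⟩, fun h => ?_⟩
      · by_contra! h'
        exact absurd ((hle i r').2 h') (not_le.2 (h ▸ hr'))
      · refine le_antisymm ((hle i r).2 h.2) ?_
        by_contra! h'
        have h1 := hs (max r' (sInf {c | i < cnt c})) (le_max_left _ _) (max_lt hr' h')
        have h2 := hs r' le_rfl hr'
        have h3 := (hle i _).1 (le_max_right r' (sInf {c | i < cnt c}))
        omega
    rw [this, encard_coe_eq_coe_finsetCard, Nat.card_Ico]
    have := hs r' le_rfl hr'
    congr 1
    omega

/-! ### Generalized eigenvalue problems for a compact operator -/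

section Pencil

open Module.End
open scoped InnerProductSpace

variable {H F : Type*} [NormedAddCommGroup H] [InnerProductSpace ℝ H] [CompleteSpace H]
  [NormedAddCommGroup F] [InnerProductSpace ℝ F] [CompleteSpace F]

/-- The solutions `f` of `⟪f, g⟫ = r * ⟪K f, K g⟫` for all `g`. -/
noncomputable def pencilSpace (K : H →L[ℝ] F) (r : ℝ) : Submodule ℝ H :=
  LinearMap.ker (LinearMap.id - r • (K.adjoint ∘L K : H →L[ℝ] H).toLinearMap)

theorem mem_pencilSpace {K : H →L[ℝ] F} {r : ℝ} {f : H} :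
    f ∈ pencilSpace K r ↔ ∀ g, ⟪f, g⟫_ℝ = r * ⟪K f, K g⟫_ℝ := by
  have : f ∈ pencilSpace K r ↔ f = r • K.adjoint (K f) := by
    simp [pencilSpace, sub_eq_zero]
  rw [this]
  refine ⟨fun h g => ?_, fun h => ext_inner_right ℝ fun g => ?_⟩
  · conv_lhs => rw [h]
    rw [real_inner_smul_left, ContinuousLinearMap.adjoint_inner_left]
  · rw [h, real_inner_smul_left, ContinuousLinearMap.adjoint_inner_left]

/-- The value `r = 0` is no exception: with `0⁻¹ = 0` the right side is the kernel of `K*K`, which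
is trivial for injective `K`. -/
theorem pencilSpace_eq_eigenspace {K : H →L[ℝ] F} (hK : Function.Injective K) (r : ℝ) :
    pencilSpace K r = eigenspace (K.adjoint ∘L K : H →L[ℝ] H).toLinearMap r⁻¹ := by
  ext f
  have h1 : f ∈ pencilSpace K r ↔ f = r • K.adjoint (K f) := by
    simp [pencilSpace, sub_eq_zero]
  rw [h1, mem_eigenspace_iff]
  simp only [ContinuousLinearMap.coe_coe, ContinuousLinearMap.comp_apply]
  rcases eq_or_ne r 0 with rfl | hr
  · simp only [zero_smul, inv_zero]
    refine ⟨fun h => by simp [h], fun h => hK ?_⟩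
    have : ⟪K.adjoint (K f), f⟫_ℝ = 0 := by simp [h]
    rw [ContinuousLinearMap.adjoint_inner_left, inner_self_eq_zero] at this
    simp [this]
  · exact ⟨fun h => by rw [eq_inv_smul_iff₀ hr]; exact h.symm,
      fun h => by rw [h, smul_inv_smul₀ hr]⟩

/-! ### Orthogonality, Rayleigh quotients and finite dimension. -/

theorem inner_map_eq_zero_of_mem_pencilSpace {K : H →L[ℝ] F} {r s : ℝ} (hrs : r ≠ s) {f g : H}
    (hf : f ∈ pencilSpace K r) (hg : g ∈ pencilSpace K s) : ⟪K f, K g⟫_ℝ = 0 := by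
  have h1 := mem_pencilSpace.1 hf g
  have h2 := mem_pencilSpace.1 hg f
  rw [real_inner_comm, real_inner_comm (K f)] at h2
  have : (r - s) * ⟪K f, K g⟫_ℝ = 0 := by linarith
  exact (mul_eq_zero.1 this).resolve_left (sub_ne_zero.2 hrs)

theorem inner_eq_zero_of_mem_pencilSpace {K : H →L[ℝ] F} {r s : ℝ} (hrs : r ≠ s) {f g : H}
    (hf : f ∈ pencilSpace K r) (hg : g ∈ pencilSpace K s) : ⟪f, g⟫_ℝ = 0 := by
  rw [mem_pencilSpace.1 hf g, inner_map_eq_zero_of_mem_pencilSpace hrs hf hg, mul_zero]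

theorem pencilSpace_eq_bot {K : H →L[ℝ] F} {r : ℝ} (hr : r ≤ 0) : pencilSpace K r = ⊥ := by
  rw [Submodule.eq_bot_iff]
  intro f hf
  have h := mem_pencilSpace.1 hf f
  have h1 := real_inner_self_nonneg (x := K f)
  have h2 := real_inner_self_nonneg (x := f)
  exact inner_self_eq_zero.1 (le_antisymm (by nlinarith) h2)

/-- Eigenvectors for distinct `r` are orthogonal for both forms, so only the diagonal terms survive.
The signs of `s - c` then give both Rayleigh bounds below. -/
theorem norm_sq_sub_of_mem_pencilSpace {K : H →L[ℝ] F} (t : Finset ℝ) (f : ℝ → H)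
    (hf : ∀ s ∈ t, f s ∈ pencilSpace K s) (c : ℝ) :
    ‖∑ s ∈ t, f s‖ ^ 2 - c * ‖K (∑ s ∈ t, f s)‖ ^ 2 = ∑ s ∈ t, (s - c) * ‖K (f s)‖ ^ 2 := by
  classical
  simp only [← real_inner_self_eq_norm_sq, map_sum, sum_inner, inner_sum]
  rw [Finset.mul_sum, ← Finset.sum_sub_distrib]
  refine Finset.sum_congr rfl fun s hs => ?_
  rw [Finset.sum_eq_single_of_mem s hs fun b hb h =>
      inner_eq_zero_of_mem_pencilSpace h (hf b hb) (hf s hs),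
    Finset.sum_eq_single_of_mem s hs fun b hb h =>
      inner_map_eq_zero_of_mem_pencilSpace h (hf b hb) (hf s hs), mem_pencilSpace.1 (hf s hs)]
  ring

theorem exists_sum_of_mem_iSup_pencilSpace {K : H →L[ℝ] F} {S : Set ℝ} {x : H}
    (hx : x ∈ ⨆ s ∈ S, pencilSpace K s) :
    ∃ (t : Finset ℝ) (f : ℝ → H), (∀ s ∈ t, s ∈ S ∧ f s ∈ pencilSpace K s) ∧
      x = ∑ s ∈ t, f s := by
  classical
  rw [iSup_subtype'] at hx
  obtain ⟨f, hf, rfl⟩ := (Submodule.mem_iSup_iff_exists_finsupp _ _).1 hx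
  refine ⟨f.support.map (Function.Embedding.subtype _),
    fun s => if h : s ∈ S then f ⟨s, h⟩ else 0, fun s hs => ?_, ?_⟩
  · obtain ⟨⟨a, ha⟩, _, rfl⟩ := Finset.mem_map.1 hs
    exact ⟨ha, by simpa [ha] using hf ⟨a, ha⟩⟩
  · rw [Finset.sum_map]
    exact Finset.sum_congr rfl fun s _ => by simp

theorem norm_sq_le_of_mem_iSup_pencilSpace {K : H →L[ℝ] F} {S : Set ℝ} {c : ℝ}
    (hS : ∀ s ∈ S, s ≤ c) {x : H} (hx : x ∈ ⨆ s ∈ S, pencilSpace K s) :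
    ‖x‖ ^ 2 ≤ c * ‖K x‖ ^ 2 := by
  obtain ⟨t, f, hf, rfl⟩ := exists_sum_of_mem_iSup_pencilSpace hx
  rw [← sub_nonpos, norm_sq_sub_of_mem_pencilSpace t f (fun s hs => (hf s hs).2)]
  exact Finset.sum_nonpos fun s hs =>
    mul_nonpos_of_nonpos_of_nonneg (sub_nonpos.2 (hS s (hf s hs).1)) (sq_nonneg _)

/-- The bound is asked only of actual eigenvalues because `S` will be the complement of a set of
eigenvalues, which contains many irrelevant small reals. -/
theorem le_norm_sq_of_mem_iSup_pencilSpace {K : H →L[ℝ] F} {S : Set ℝ} {c : ℝ}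
    (hS : ∀ s ∈ S, pencilSpace K s ≠ ⊥ → c ≤ s) {x : H} (hx : x ∈ ⨆ s ∈ S, pencilSpace K s) :
    c * ‖K x‖ ^ 2 ≤ ‖x‖ ^ 2 := by
  obtain ⟨t, f, hf, rfl⟩ := exists_sum_of_mem_iSup_pencilSpace hx
  rw [← sub_nonneg, norm_sq_sub_of_mem_pencilSpace t f (fun s hs => (hf s hs).2)]
  refine Finset.sum_nonneg fun s hs => ?_
  by_cases h : pencilSpace K s = ⊥
  · have : f s = 0 := by simpa [h] using (hf s hs).2
    simp [this]
  · exact mul_nonneg (sub_nonneg.2 (hS s (hf s hs).1 h)) (sq_nonneg _)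

-- A compact map bounded below on `E` forces finite dimension: otherwise `E` contains a bounded
-- 1-separated sequence, whose image stays separated yet has a convergent subsequence.
omit [CompleteSpace H] [CompleteSpace F] in
theorem finiteDimensional_of_norm_sq_le {K : H →L[ℝ] F} (hK : IsCompactOperator K)
    {E : Submodule ℝ H} {c : ℝ} (hE : ∀ x ∈ E, ‖x‖ ^ 2 ≤ c * ‖K x‖ ^ 2) :
    FiniteDimensional ℝ E := by
  by_contra hfin
  obtain ⟨R, f, hR, hf, hsep⟩ := exists_seq_norm_le_one_le_norm_sub hfin
  obtain ⟨C, hC, hsub⟩ := hK.image_closedBall_subset_compact (f := K.toLinearMap) R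
  have hmem : ∀ n, K (f n) ∈ C := fun n =>
    hsub ⟨f n, by simpa using hf n, rfl⟩
  obtain ⟨a, -, φ, hφ, hlim⟩ := hC.tendsto_subseq hmem
  have hcau := hlim.cauchySeq
  have hsep' : ∀ m n, m ≠ n → 1 ≤ c * ‖K (f m) - K (f n)‖ ^ 2 := fun m n h => by
    have h1 := hE _ (f m - f n).2
    have h2 : 1 ≤ ‖((f m - f n : E) : H)‖ := hsep h
    rw [← map_sub]
    calc (1 : ℝ) ≤ ‖((f m - f n : E) : H)‖ ^ 2 := one_le_pow₀ h2
      _ ≤ _ := h1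
  rw [Metric.cauchySeq_iff'] at hcau
  have hc : 0 < c := by
    by_contra! h
    have := hsep' 0 1 (by simp)
    nlinarith [sq_nonneg ‖K (f 0) - K (f 1)‖]
  obtain ⟨n, hn⟩ := hcau (Real.sqrt c⁻¹) (by positivity)
  have h1 := hn (n + 1) (by simp)
  have h2 := hsep' (φ (n + 1)) (φ n) (hφ.injective.ne (by simp))
  rw [dist_eq_norm] at h1
  have h3 : ‖K (f (φ (n + 1))) - K (f (φ n))‖ ^ 2 < c⁻¹ := by
    rw [← Real.sq_sqrt (inv_nonneg.2 hc.le)]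
    exact pow_lt_pow_left₀ h1 (norm_nonneg _) (by simp)
  have := mul_lt_mul_of_pos_left h3 hc
  rw [mul_inv_cancel₀ hc.ne'] at this
  linarith

theorem finiteDimensional_iSup_pencilSpace {K : H →L[ℝ] F} (hK : IsCompactOperator K)
    {S : Set ℝ} {c : ℝ} (hS : ∀ s ∈ S, s ≤ c) :
    FiniteDimensional ℝ (⨆ s ∈ S, pencilSpace K s : Submodule ℝ H) :=
  finiteDimensional_of_norm_sq_le hK fun _ => norm_sq_le_of_mem_iSup_pencilSpace hS

theorem finiteDimensional_pencilSpace {K : H →L[ℝ] F} (hK : IsCompactOperator K) (r : ℝ) :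
    FiniteDimensional ℝ (pencilSpace K r) :=
  finiteDimensional_of_norm_sq_le (c := r) hK fun x hx => by
    have := mem_pencilSpace.1 hx x
    rw [real_inner_self_eq_norm_sq, real_inner_self_eq_norm_sq] at this
    exact this.le

/-- This is the spectral theorem for `K*K`, reindexed by the surjection `r ↦ r⁻¹` of `ℝ`. -/
theorem orthogonal_iSup_pencilSpace {K : H →L[ℝ] F} (hK : IsCompactOperator K)
    (hinj : Function.Injective K) : (⨆ s, pencilSpace K s)ᗮ = ⊥ := by
  have h := ContinuousLinearMap.orthogonalComplement_iSup_eigenspaces_eq_bot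
    (T := K.adjoint ∘L K) (hK.clm_comp K.adjoint) (K.isPositive_adjoint_comp_self).isSymmetric
  rw [← h]
  congr 1
  simp only [pencilSpace_eq_eigenspace hinj]
  exact (inv_surjective (G := ℝ)).iSup_comp (fun r => eigenspace (K.adjoint ∘L K : H →L[ℝ] H).toLinearMap r)

/-- By completeness of the eigenvectors, `x` lies in the closure of the span of the remaining
eigenspaces. The Rayleigh bound holds on that span and passes to the closure. -/
theorem le_norm_sq_of_mem_orthogonal {K : H →L[ℝ] F} (hK : IsCompactOperator K)
    (hinj : Function.Injective K) {S : Set ℝ} {c : ℝ}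
    (hS : ∀ s ∉ S, pencilSpace K s ≠ ⊥ → c ≤ s) {x : H}
    (hx : x ∈ (⨆ s ∈ S, pencilSpace K s)ᗮ) : c * ‖K x‖ ^ 2 ≤ ‖x‖ ^ 2 := by
  set G := ⨆ s ∈ Sᶜ, pencilSpace K s with hG
  have horth : (⨆ s ∈ S, pencilSpace K s) ⟂ G := by
    simp only [hG, Submodule.isOrtho_iSup_left, Submodule.isOrtho_iSup_right]
    intro s hs r hr
    rw [Submodule.isOrtho_iff_inner_eq]
    exact fun f hf g hg =>
      inner_eq_zero_of_mem_pencilSpace (fun h : r = s => hs (h ▸ hr)) hf hg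
  have hcl : x ∈ G.topologicalClosure := by
    have : CompleteSpace G.topologicalClosure := G.isClosed_topologicalClosure.completeSpace_coe
    obtain ⟨p, hp, y, hy, rfl⟩ := G.topologicalClosure.exists_add_mem_mem_orthogonal x
    have hpo : p ∈ (⨆ s ∈ S, pencilSpace K s)ᗮ :=
      G.topologicalClosure_minimal horth.symm (Submodule.isClosed_orthogonal _) hp
    have hyo : y ∈ (⨆ s ∈ S, pencilSpace K s)ᗮ := by
      simpa using Submodule.sub_mem _ hx hpo
    have hyG : y ∈ Gᗮ := by rwa [Submodule.orthogonal_closure] at hy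
    have : y ∈ (⨆ s, pencilSpace K s)ᗮ := by
      rw [← Submodule.iInf_orthogonal, Submodule.mem_iInf]
      intro s
      by_cases hs : s ∈ S
      · exact Submodule.orthogonal_le (le_iSup₂_of_le s hs le_rfl) hyo
      · exact Submodule.orthogonal_le (le_iSup₂_of_le (f := fun s (_ : s ∈ Sᶜ) => pencilSpace K s)
          s hs le_rfl) hyG
    rw [orthogonal_iSup_pencilSpace hK hinj, Submodule.mem_bot] at this
    rwa [this, add_zero]
  have hclosed : IsClosed {x | c * ‖K x‖ ^ 2 ≤ ‖x‖ ^ 2} :=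
    isClosed_le (by fun_prop) (by fun_prop)
  exact closure_minimal (fun y hy => le_norm_sq_of_mem_iSup_pencilSpace hS hy) hclosed hcl

theorem finrank_iSup_pencilSpace {K : H →L[ℝ] F} (hK : IsCompactOperator K) (t : Finset ℝ) :
    Module.finrank ℝ (⨆ s ∈ t, pencilSpace K s : Submodule ℝ H) =
      ∑ s ∈ t, Module.finrank ℝ (pencilSpace K s) := by
  classical
  have := finiteDimensional_pencilSpace hK
  induction t using Finset.induction_on with
  | empty => rw [show (⨆ s ∈ (∅ : Finset ℝ), pencilSpace K s) = ⊥ by simp, finrank_bot, Finset.sum_empty]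
  | insert a t ha ih =>
    have hfin : FiniteDimensional ℝ (⨆ s ∈ t, pencilSpace K s : Submodule ℝ H) :=
      Submodule.finiteDimensional_finset_sup t _ |> fun h => by rwa [Finset.sup_eq_iSup] at h
    have hd : pencilSpace K a ⟂ ⨆ s ∈ t, pencilSpace K s := by
      simp only [Submodule.isOrtho_iSup_right]
      intro s hs
      rw [Submodule.isOrtho_iff_inner_eq]
      exact fun f hf g hg =>
        inner_eq_zero_of_mem_pencilSpace (fun h : a = s => ha (h ▸ hs)) hf hg
    rw [Finset.iSup_insert, Finset.sum_insert ha, ← ih,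
      ← Submodule.finrank_sup_add_finrank_inf_eq, hd.disjoint.eq_bot, finrank_bot, add_zero]

/-! ### Enumeration of the eigenvalues and the comparison principle. -/

/-- `P` lists the solutions `r` of the eigenvalue problem `⟪f, g⟫ = r * ⟪K f, K g⟫` in
nondecreasing order, with multiplicity. -/
structure IsPencilSequence (K : H →L[ℝ] F) (P : ℕ → ℝ) : Prop where
  mono : Monotone P
  multiplicity : ∀ r : ℝ,
    {i : ℕ | P i = r}.encard = Cardinal.toENat (Module.rank ℝ (pencilSpace K r))

theorem exists_isPencilSequence {K : H →L[ℝ] F} (hK : IsCompactOperator K)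
    (hinj : Function.Injective K) (hH : ¬ FiniteDimensional ℝ H) :
    ∃ P, IsPencilSequence K P := by
  have hfd := finiteDimensional_pencilSpace hK
  -- Infinitely many eigenvalues below `c` would give arbitrarily many independent vectors in one
  -- finite-dimensional space.
  have hfin : ∀ c : ℝ, {s | s ≤ c ∧ Module.finrank ℝ (pencilSpace K s) ≠ 0}.Finite := fun c => by
    have hlow := finiteDimensional_iSup_pencilSpace hK (S := Iic c) fun _ h => h
    by_contra hinf
    obtain ⟨t, ht, hcard⟩ := Set.Infinite.exists_subset_card_eq hinf
      (Module.finrank ℝ (⨆ s ∈ Iic c, pencilSpace K s : Submodule ℝ H) + 1)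
    have h1 : (⨆ s ∈ t, pencilSpace K s) ≤ ⨆ s ∈ Iic c, pencilSpace K s :=
      iSup₂_le fun s hs => le_iSup₂_of_le (f := fun s (_ : s ∈ Iic c) => pencilSpace K s)
        s (ht hs).1 le_rfl
    have h2 := Submodule.finrank_mono h1
    rw [finrank_iSup_pencilSpace hK] at h2
    have h3 : t.card ≤ ∑ s ∈ t, Module.finrank ℝ (pencilSpace K s) := by
      rw [Finset.card_eq_sum_ones]
      exact Finset.sum_le_sum fun s hs => Nat.one_le_iff_ne_zero.2 (ht hs).2
    omega
  -- With finitely many eigenvalues the dense span of the eigenspaces would be finite dimensional,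
  -- hence all of `H`.
  have hinf : {s | Module.finrank ℝ (pencilSpace K s) ≠ 0}.Infinite := fun hfin => by
    refine hH ?_
    obtain ⟨c, hc⟩ := hfin.bddAbove
    have hlow := finiteDimensional_iSup_pencilSpace hK (S := Iic c) fun _ h => h
    have hle : (⨆ s, pencilSpace K s) ≤ ⨆ s ∈ Iic c, pencilSpace K s := by
      refine iSup_le fun s => ?_
      by_cases hs : s ≤ c
      · exact le_iSup₂_of_le (f := fun s (_ : s ∈ Iic c) => pencilSpace K s) s hs le_rfl
      · have : Module.finrank ℝ (pencilSpace K s) = 0 := by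
          by_contra h
          exact hs (hc h)
        rw [Submodule.finrank_eq_zero.1 this]
        exact bot_le
    have hbot := orthogonal_iSup_pencilSpace hK hinj
    have h2 : (⨆ s ∈ Iic c, pencilSpace K s)ᗮ = ⊥ :=
      le_bot_iff.1 ((Submodule.orthogonal_le hle).trans hbot.le)
    rw [Submodule.orthogonal_eq_bot_iff] at h2
    rw [h2] at hlow
    exact Module.Finite.equiv Submodule.topEquiv
  obtain ⟨P, hP, hm⟩ := exists_monotone_encard_fiber_eq
    (fun r => Module.finrank ℝ (pencilSpace K r))
    (fun r hr => by rw [pencilSpace_eq_bot hr, finrank_bot]) hfin hinf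
  refine ⟨P, hP, fun r => ?_⟩
  rw [hm, ← Module.finrank_eq_rank, map_natCast]

theorem IsPencilSequence.encard_eq_finrank {K : H →L[ℝ] F} (hK : IsCompactOperator K) {P : ℕ → ℝ}
    (hP : IsPencilSequence K P) (r : ℝ) :
    {i | P i = r}.encard = Module.finrank ℝ (pencilSpace K r) := by
  have := finiteDimensional_pencilSpace hK r
  rw [hP.multiplicity, ← Module.finrank_eq_rank, map_natCast]

theorem IsPencilSequence.le_of_norm_le {H' F' : Type*} [NormedAddCommGroup H']
    [InnerProductSpace ℝ H'] [CompleteSpace H'] [NormedAddCommGroup F'] [InnerProductSpace ℝ F']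
    [CompleteSpace F'] {K : H →L[ℝ] F} {K' : H' →L[ℝ] F'}
    (hK : IsCompactOperator K) (hinj : Function.Injective K) (hK' : IsCompactOperator K')
    (hinj' : Function.Injective K') {P P' : ℕ → ℝ} (hP : IsPencilSequence K P)
    (hP' : IsPencilSequence K' P') (S : H →ₗ[ℝ] H') (hS : ∀ f, ‖S f‖ ≤ ‖f‖)
    (hKS : ∀ f, ‖K' (S f)‖ = ‖K f‖) (i : ℕ) : P' i ≤ P i := by
  classical
  set t := (Finset.range (i + 1)).image P with ht
  -- The strict inequality discards an eigenvalue equal to `P' i`, whose multiplicity may run past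
  -- index `i`. All copies of the retained values have index below `i`, whence `hBdim`.
  set t' := ((Finset.range i).filter fun j => P' j < P' i).image P' with ht'
  set A := ⨆ s ∈ (t : Set ℝ), pencilSpace K s with hA
  set B := ⨆ s ∈ (t' : Set ℝ), pencilSpace K' s with hB
  have hAle : ∀ x ∈ A, ‖x‖ ^ 2 ≤ P i * ‖K x‖ ^ 2 := fun x =>
    norm_sq_le_of_mem_iSup_pencilSpace fun s hs => by
      obtain ⟨j, hj, rfl⟩ := Finset.mem_image.1 (Finset.mem_coe.1 hs)
      exact hP.mono (Nat.lt_succ_iff.1 (Finset.mem_range.1 hj))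
  have hBge : ∀ x ∈ Bᗮ, P' i * ‖K' x‖ ^ 2 ≤ ‖x‖ ^ 2 := fun x =>
    le_norm_sq_of_mem_orthogonal hK' hinj' fun s hs hne => by
      have h1 := hP'.encard_eq_finrank hK' s
      have h2 : {j | P' j = s}.Nonempty := by
        rw [← encard_ne_zero, h1, Nat.cast_ne_zero]
        have := finiteDimensional_pencilSpace hK' s
        exact fun h => hne (Submodule.finrank_eq_zero.1 h)
      obtain ⟨j, rfl⟩ := h2
      by_contra! hlt
      refine hs (Finset.mem_coe.2 (Finset.mem_image.2 ⟨j, ?_, rfl⟩))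
      rw [Finset.mem_filter, Finset.mem_range]
      exact ⟨hP'.mono.reflect_lt hlt, hlt⟩
  have hAfin : FiniteDimensional ℝ A := finiteDimensional_of_norm_sq_le hK hAle
  have hBfin : FiniteDimensional ℝ B := by
    refine finiteDimensional_iSup_pencilSpace hK' (c := P' i) fun s hs => ?_
    obtain ⟨j, hj, rfl⟩ := Finset.mem_image.1 (Finset.mem_coe.1 hs)
    exact (Finset.mem_filter.1 hj).2.le
  have hAdim : i + 1 ≤ Module.finrank ℝ A := by
    have h : Module.finrank ℝ A = _ := finrank_iSup_pencilSpace hK t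
    rw [h, ← Finset.card_range (i + 1), Finset.card_eq_sum_card_image P (Finset.range (i + 1))]
    refine Finset.sum_le_sum fun s _ => ?_
    rw [← Nat.cast_le (α := ℕ∞), ← hP.encard_eq_finrank hK s, ← encard_coe_eq_coe_finsetCard]
    exact encard_le_encard fun j hj => (Finset.mem_filter.1 (Finset.mem_coe.1 hj)).2
  have hBdim : Module.finrank ℝ B ≤ i := by
    have h : Module.finrank ℝ B = _ := finrank_iSup_pencilSpace hK' t'
    refine h.le.trans (le_trans ?_ ((Finset.card_filter_le (Finset.range i) fun j => P' j < P' i).trans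
      (Finset.card_range i).le))
    rw [Finset.card_eq_sum_card_image P']
    refine Finset.sum_le_sum fun s hs => ?_
    rw [← Nat.cast_le (α := ℕ∞), ← hP'.encard_eq_finrank hK' s, ← encard_coe_eq_coe_finsetCard]
    refine encard_le_encard fun j hj => ?_
    obtain ⟨k, hk, rfl⟩ := Finset.mem_image.1 hs
    have hk := (Finset.mem_filter.1 hk).2
    have hj : P' j = P' k := hj
    simp only [Finset.coe_filter, Finset.mem_filter, Finset.mem_range, mem_ofPred_eq]
    exact ⟨⟨hP'.mono.reflect_lt (hj ▸ hk), hj ▸ hk⟩, hj⟩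
  -- Since `dim A > dim B`, the map sending `x` in `A` to the projection of `S x` onto `B` has a
  -- nontrivial kernel.
  obtain ⟨⟨x, hxA⟩, hx, hx0⟩ := Submodule.exists_mem_ne_zero_of_ne_bot
    (LinearMap.ker_ne_bot_of_finrank_lt
      (f := (B.orthogonalProjectionOnto : H' →ₗ[ℝ] B) ∘ₗ S ∘ₗ A.subtype) (by omega))
  have hxB : S x ∈ Bᗮ := by simpa using hx
  have hKx : 0 < ‖K x‖ ^ 2 := by
    refine pow_pos (norm_pos_iff.2 fun h => hx0 ?_) 2
    exact Subtype.ext (hinj (by simpa using h))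
  have h1 := hAle x hxA
  have h2 := hBge _ hxB
  rw [hKS] at h2
  have h3 : ‖S x‖ ^ 2 ≤ ‖x‖ ^ 2 := pow_le_pow_left₀ (norm_nonneg _) (hS x) 2
  exact le_of_mul_le_mul_right (h2.trans (h3.trans h1)) hKx

end Pencil

noncomputable section

namespace Beam

open BoundedContinuousFunction

variable {L : ℝ}

/-! ### Primitives of square integrable functions -/

theorem L2.intervalIntegrable (g : L2 L) {a b : ℝ} (ha : a ∈ Icc 0 L) (hb : b ∈ Icc 0 L) :
    IntervalIntegrable g volume a b := by
  have h1 : IntegrableOn g (Ioo 0 L) volume := (Lp.memLp g).integrable (by norm_num)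
  have h2 : IntegrableOn g (Icc 0 L) volume := by
    rwa [integrableOn_Icc_iff_integrableOn_Ioo]
  exact (h2.mono_set (uIcc_subset_Icc ha hb)).intervalIntegrable

theorem intervalIntegral_congr_ae_Ioo {f g : ℝ → ℝ}
    (h : f =ᵐ[volume.restrict (Ioo 0 L)] g) {a b : ℝ} (ha : a ∈ Icc 0 L) (hb : b ∈ Icc 0 L) :
    ∫ t in a..b, f t = ∫ t in a..b, g t := by
  refine intervalIntegral.integral_congr_ae ?_
  rw [Filter.EventuallyEq, Measure.restrict_congr_set Ioo_ae_eq_Icc,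
    ae_restrict_iff' measurableSet_Icc] at h
  filter_upwards [h] with t ht hmem
  exact ht (uIcc_subset_Icc ha hb (uIoc_subset_uIcc hmem))

/-- Cauchy–Schwarz against the indicator of `(a, b)`. This common Hölder modulus supplies the
equicontinuity for Arzelà–Ascoli. -/
theorem abs_intervalIntegral_le (g : L2 L) {a b : ℝ} (ha : a ∈ Icc 0 L) (hb : b ∈ Icc 0 L) :
    |∫ t in a..b, g t| ≤ √|b - a| * ‖g‖ := by
  wlog hab : a ≤ b generalizing a b
  · rw [intervalIntegral.integral_symm, abs_neg, abs_sub_comm]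
    exact this hb ha (le_of_not_ge hab)
  have hsub : Ioo a b ⊆ Ioo 0 L := Ioo_subset_Ioo ha.1 hb.2
  have hfin : volume.restrict (Ioo 0 L) (Ioo a b) ≠ ⊤ := measure_ne_top _ _
  have h1 : ∫ t in a..b, g t = inner ℝ (indicatorConstLp 2 measurableSet_Ioo hfin (1 : ℝ)) g := by
    rw [L2.inner_indicatorConstLp_one, Measure.restrict_restrict measurableSet_Ioo,
      inter_eq_self_of_subset_left hsub, intervalIntegral.integral_of_le hab,
      integral_Ioc_eq_integral_Ioo]
  rw [h1]
  refine (abs_real_inner_le_norm _ _).trans (mul_le_mul_of_nonneg_right ?_ (norm_nonneg _))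
  rw [norm_indicatorConstLp (by simp) (by simp), measureReal_restrict_apply measurableSet_Ioo,
    inter_eq_self_of_subset_left hsub, Real.volume_real_Ioo_of_le hab, Real.sqrt_eq_rpow,
    abs_of_nonneg (sub_nonneg.2 hab)]
  simp

theorem continuous_intervalIntegral (hL : 0 < L) (g : L2 L) :
    Continuous fun x : Icc 0 L => ∫ t in (0 : ℝ)..x, g t := by
  have h := intervalIntegral.continuousOn_primitive_interval'
    (g.intervalIntegrable (left_mem_Icc.2 hL.le) (right_mem_Icc.2 hL.le)) (left_mem_uIcc)
  rw [uIcc_of_le hL.le] at h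
  exact h.domRestrict

/-- The primitive `x ↦ ∫₀ˣ g` of `g ∈ L²(0, L)`, as a continuous function on `[0, L]`. -/
def primitive (hL : 0 < L) : L2 L →L[ℝ] (Icc 0 L →ᵇ ℝ) :=
  LinearMap.mkContinuous
    { toFun := fun g => mkOfCompact
        ⟨fun x => ∫ t in (0 : ℝ)..x, g t, continuous_intervalIntegral hL g⟩
      map_add' := fun g h => by
        ext x
        have h0 := left_mem_Icc.2 hL.le
        simp only [mkOfCompact_apply, ContinuousMap.coe_mk, BoundedContinuousFunction.coe_add,
          Pi.add_apply]
        rw [← intervalIntegral.integral_add (g.intervalIntegrable h0 x.2)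
          (h.intervalIntegrable h0 x.2)]
        exact intervalIntegral_congr_ae_Ioo (Lp.coeFn_add g h) h0 x.2
      map_smul' := fun c g => by
        ext x
        simp only [mkOfCompact_apply, ContinuousMap.coe_mk, BoundedContinuousFunction.coe_smul,
          RingHom.id_apply, smul_eq_mul]
        rw [← intervalIntegral.integral_const_mul]
        exact intervalIntegral_congr_ae_Ioo (Lp.coeFn_smul c g) (left_mem_Icc.2 hL.le) x.2 }
    √L fun g => by
      refine (norm_le (by positivity)).2 fun x => ?_
      refine (abs_intervalIntegral_le g (left_mem_Icc.2 hL.le) x.2).trans ?_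
      refine mul_le_mul_of_nonneg_right (Real.sqrt_le_sqrt ?_) (norm_nonneg _)
      rw [sub_zero, abs_of_nonneg x.2.1]
      exact x.2.2

theorem primitive_apply (hL : 0 < L) (g : L2 L) (x : Icc 0 L) :
    primitive hL g x = ∫ t in (0 : ℝ)..x, g t := rfl

theorem dist_primitive_le (hL : 0 < L) (g : L2 L) (x y : Icc 0 L) :
    dist (primitive hL g x) (primitive hL g y) ≤ √(dist x y) * ‖g‖ := by
  have h0 := left_mem_Icc.2 hL.le
  rw [Real.dist_eq, primitive_apply, primitive_apply, intervalIntegral.integral_interval_sub_left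
    (g.intervalIntegrable h0 x.2) (g.intervalIntegrable h0 y.2), Subtype.dist_eq, Real.dist_eq]
  exact abs_intervalIntegral_le g y.2 x.2

theorem isCompactOperator_primitive (hL : 0 < L) : IsCompactOperator (primitive hL) := by
  refine (isCompactOperator_iff_isCompact_closure_image_closedBall
    (primitive hL).toLinearMap one_pos).2 ?_
  refine arzela_ascoli (Metric.closedBall 0 ‖primitive hL‖) (isCompact_closedBall _ _) _ ?_ ?_
  · rintro _ x ⟨g, hg, rfl⟩
    rw [mem_closedBall_zero_iff] at hg ⊢
    exact (norm_coe_le_norm _ x).trans ((primitive hL).unit_le_opNorm g hg)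
  · refine Metric.equicontinuous_of_continuity_modulus Real.sqrt ?_ _ ?_
    · simpa using Real.continuous_sqrt.tendsto 0
    · rintro x y ⟨_, g, hg, rfl⟩
      rw [mem_closedBall_zero_iff] at hg
      exact (dist_primitive_le hL g x y).trans
        (mul_le_of_le_one_right (Real.sqrt_nonneg _) hg)

/-- The extension of a continuous function on `[0, L]` by its boundary values. -/
def extendIcc (hL : 0 < L) : (Icc 0 L →ᵇ ℝ) →L[ℝ] (ℝ →ᵇ ℝ) :=
  LinearMap.mkContinuous
    { toFun := fun f => f.compContinuous ⟨projIcc 0 L hL.le, continuous_projIcc⟩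
      map_add' := fun f g => rfl
      map_smul' := fun (c : ℝ) f => rfl }
    1 fun f => by
      rw [one_mul]
      exact (norm_le (norm_nonneg _)).2 fun x => norm_coe_le_norm f _

/-- A continuous function on `[0, L]`, as an element of `L²(0, L)`. -/
def ofCont (hL : 0 < L) : (Icc 0 L →ᵇ ℝ) →L[ℝ] L2 L :=
  (toLp 2 (volume.restrict (Ioo 0 L)) ℝ).comp (extendIcc hL)

theorem coeFn_ofCont (hL : 0 < L) (f : Icc 0 L →ᵇ ℝ) :
    ofCont hL f =ᵐ[volume.restrict (Ioo 0 L)] IccExtend hL.le f :=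
  coeFn_toLp (𝕜 := ℝ) (p := 2) (volume.restrict (Ioo 0 L)) (extendIcc hL f)

/-- Used to recover endpoint values of a continuous representative from its L² class. -/
theorem ofCont_injective (hL : 0 < L) : Function.Injective (ofCont hL) := by
  intro f g h
  have h1 : IccExtend hL.le f =ᵐ[volume.restrict (Icc 0 L)] IccExtend hL.le g := by
    rw [← Measure.restrict_congr_set Ioo_ae_eq_Icc]
    exact (coeFn_ofCont hL f).symm.trans (h ▸ coeFn_ofCont hL g)
  have h2 := Measure.eqOn_Icc_of_ae_eq volume hL.ne h1
    f.continuous.Icc_extend'.continuousOn g.continuous.Icc_extend'.continuousOn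
  ext x
  simpa using h2 x.2

/-- The primitive of `g ∈ L²(0, L)` that vanishes at `0`, as an element of `L²(0, L)`. -/
def antideriv (hL : 0 < L) : L2 L →L[ℝ] L2 L := ofCont hL ∘L primitive hL

theorem isCompactOperator_antideriv (hL : 0 < L) : IsCompactOperator (antideriv hL) :=
  (isCompactOperator_primitive hL).clm_comp (ofCont hL)

theorem coeFn_antideriv (hL : 0 < L) (g : L2 L) :
    antideriv hL g =ᵐ[volume.restrict (Ioo 0 L)] fun x => ∫ t in (0 : ℝ)..x, g t := by
  refine (coeFn_ofCont hL _).trans ?_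
  refine (ae_restrict_iff' measurableSet_Ioo).2 (Filter.Eventually.of_forall fun x hx => ?_)
  exact IccExtend_of_mem hL.le _ (Ioo_subset_Icc_self hx)

theorem IsTest.apply_zero {φ : ℝ → ℝ} (h : IsTest L φ) : φ 0 = 0 :=
  image_eq_zero_of_notMem_tsupport fun hx => lt_irrefl _ (h.inside hx).1

theorem IsTest.apply_right {φ : ℝ → ℝ} (h : IsTest L φ) : φ L = 0 :=
  image_eq_zero_of_notMem_tsupport fun hx => lt_irrefl _ (h.inside hx).2

theorem hasWeakDeriv_antideriv (hL : 0 < L) (g : L2 L) : HasWeakDeriv L (antideriv hL g) g := by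
  intro φ hφ
  have hg := g.intervalIntegrable (left_mem_Icc.2 hL.le) (right_mem_Icc.2 hL.le)
  set G : ℝ → ℝ := fun x => ∫ t in (0 : ℝ)..x, g t with hG
  have hGac : AbsolutelyContinuousOnInterval G 0 L :=
    hg.absolutelyContinuousOnInterval_intervalIntegral left_mem_uIcc
  have hφac : AbsolutelyContinuousOnInterval φ 0 L :=
    (hφ.smooth.of_le (by simp)).contDiffOn.absolutelyContinuousOnInterval
  have h1 : ∫ x in Ioo 0 L, antideriv hL g x * deriv φ x = ∫ x in (0 : ℝ)..L, G x * deriv φ x := by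
    rw [intervalIntegral.integral_of_le hL.le, integral_Ioc_eq_integral_Ioo]
    refine integral_congr_ae ?_
    filter_upwards [coeFn_antideriv hL g] with x hx
    rw [hx]
  have h2 : ∫ x in Ioo 0 L, g x * φ x = ∫ x in (0 : ℝ)..L, deriv G x * φ x := by
    rw [← integral_Ioc_eq_integral_Ioo, ← intervalIntegral.integral_of_le hL.le]
    refine intervalIntegral.integral_congr_ae ?_
    filter_upwards [hg.ae_hasDerivAt_integral] with x hx hmem
    rw [(hx (uIoc_subset_uIcc hmem) 0 left_mem_uIcc).deriv]
  rw [h1, h2, hGac.integral_mul_deriv_eq_deriv_mul hφac, hφ.apply_zero, hφ.apply_right]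
  ring

theorem antideriv_injective (hL : 0 < L) : Function.Injective (antideriv hL) := fun g h e =>
  (hasWeakDeriv_antideriv hL g).unique (e ▸ hasWeakDeriv_antideriv hL h)

/-! ### Functions with vanishing weak derivative -/

theorem IsTest.exists_integral_eq_one (hL : 0 < L) :
    ∃ φ, IsTest L φ ∧ ∫ x in Ioo 0 L, φ x = 1 := by
  let f : ContDiffBump (L / 2) := ⟨L / 8, L / 4, by positivity, by linarith⟩
  have hsub : tsupport f ⊆ Ioo 0 L := by
    rw [f.tsupport_eq, Real.closedBall_eq_Icc]
    intro x hx
    have h1 : L / 2 - L / 4 ≤ x := hx.1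
    have h2 : x ≤ L / 2 + L / 4 := hx.2
    exact ⟨by linarith, by linarith⟩
  refine ⟨f.normed volume, ⟨f.contDiff_normed, f.hasCompactSupport_normed, ?_⟩, ?_⟩
  · rwa [f.tsupport_normed_eq, ← f.tsupport_eq]
  · rw [setIntegral_eq_integral_of_forall_compl_eq_zero, f.integral_normed]
    intro x hx
    refine image_eq_zero_of_notMem_tsupport fun h => hx (hsub ?_)
    rwa [f.tsupport_normed_eq, ← f.tsupport_eq] at h

/-- Zero mean is what makes the primitive vanish to the right of the support as well. -/
theorem IsTest.primitive {θ : ℝ → ℝ} (hL : 0 < L) (hθ : IsTest L θ)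
    (h0 : ∫ x in Ioo 0 L, θ x = 0) : IsTest L (fun x => ∫ t in (0 : ℝ)..x, θ t) := by
  have hc := hθ.smooth.continuous
  have hd : ∀ x, HasDerivAt (fun x => ∫ t in (0 : ℝ)..x, θ t) (θ x) x := fun x =>
    intervalIntegral.integral_hasDerivAt_right (hc.intervalIntegrable _ _)
      (hc.stronglyMeasurableAtFilter _ _) hc.continuousAt
  obtain ⟨a, b, ha, hb, hab⟩ : ∃ a b, 0 < a ∧ b < L ∧ ∀ x, x < a ∨ b < x → θ x = 0 := by
    -- Inserting `L / 2` keeps the compact set nonempty when `θ = 0`.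
    have hK : IsCompact (insert (L / 2) (tsupport θ)) := hθ.compact.isCompact.insert _
    have hsub : insert (L / 2) (tsupport θ) ⊆ Ioo 0 L :=
      insert_subset ⟨by linarith, by linarith⟩ hθ.inside
    obtain ⟨a, ha⟩ := hK.exists_isLeast (insert_nonempty _ _)
    obtain ⟨b, hb⟩ := hK.exists_isGreatest (insert_nonempty _ _)
    refine ⟨a, b, (hsub ha.1).1, (hsub hb.1).2, fun x hx => ?_⟩
    refine image_eq_zero_of_notMem_tsupport fun h => ?_
    rcases hx with hx | hx
    · exact absurd (ha.2 (mem_insert_of_mem _ h)) (not_le.2 hx)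
    · exact absurd (hb.2 (mem_insert_of_mem _ h)) (not_le.2 hx)
  have hsupp : tsupport (fun x => ∫ t in (0 : ℝ)..x, θ t) ⊆ Icc a b := by
    refine closure_minimal (fun x hx => ?_) isClosed_Icc
    by_contra hmem
    rw [mem_Icc, not_and_or, not_le, not_le] at hmem
    refine hx ?_
    rcases hmem with h | h
    · refine intervalIntegral.integral_zero_ae (Filter.Eventually.of_forall fun t ht => ?_)
      exact hab t (Or.inl (ht.2.trans_lt (max_lt ha h)))
    · have h1 : ∫ t in (0 : ℝ)..L, θ t = 0 := by
        rwa [intervalIntegral.integral_of_le hL.le, integral_Ioc_eq_integral_Ioo]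
      have h2 : ∫ t in L..x, θ t = 0 := by
        refine intervalIntegral.integral_zero_ae (Filter.Eventually.of_forall fun t ht => ?_)
        exact hab t (Or.inr ((lt_min hb h).trans ht.1))
      change ∫ t in (0 : ℝ)..x, θ t = 0
      rw [← intervalIntegral.integral_add_adjacent_intervals (hc.intervalIntegrable 0 L)
        (hc.intervalIntegrable L x), h1, h2, add_zero]
  refine ⟨?_, isCompact_Icc.of_isClosed_subset (isClosed_tsupport _) hsupp,
    hsupp.trans fun x hx => ⟨ha.trans_le hx.1, hx.2.trans_lt hb⟩⟩
  rw [contDiff_infty_iff_deriv]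
  refine ⟨fun x => (hd x).differentiableAt, ?_⟩
  rw [funext fun x => (hd x).deriv]
  exact hθ.smooth

/-- The du Bois-Reymond argument: `φ - (∫ φ) η` has zero mean, so it is the derivative of a test
function. Equality in L² follows because `u` and the constant are both weak derivatives of
`antideriv hL u`. -/
theorem HasWeakDeriv.eq_const (hL : 0 < L) {u : L2 L} (hu : HasWeakDeriv L u 0) :
    ∃ c : ℝ, u = ofCont hL (BoundedContinuousFunction.const _ c) := by
  obtain ⟨η, hη, hη1⟩ := IsTest.exists_integral_eq_one hL
  have hint : ∀ {φ}, IsTest L φ → Integrable φ (volume.restrict (Ioo 0 L)) := fun hφ =>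
    (hφ.smooth.continuous.integrable_of_hasCompactSupport hφ.compact).restrict
  refine ⟨∫ x in Ioo 0 L, u x * η x, (hasWeakDeriv_antideriv hL u).unique fun φ hφ => ?_⟩
  set c := ∫ x in Ioo 0 L, u x * η x with hc
  set d := ∫ x in Ioo 0 L, φ x with hd
  have hθ : IsTest L (fun x => φ x - d * η x) := by
    refine ⟨hφ.smooth.sub (contDiff_const.mul hη.smooth), hφ.compact.sub hη.compact.mul_left, ?_⟩
    refine (tsupport_sub _ _).trans (union_subset hφ.inside ?_)
    exact (tsupport_mul_subset_right (f := fun _ => d)).trans hη.inside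
  have hθ0 : ∫ x in Ioo 0 L, (φ x - d * η x) = 0 := by
    rw [integral_sub (hint hφ) ((hint hη).const_mul d), integral_const_mul, hη1]
    simp [hd]
  have h1 := hu _ (hθ.primitive hL hθ0)
  have h2 : ∀ x, deriv (fun x => ∫ t in (0 : ℝ)..x, (φ t - d * η t)) x = φ x - d * η x := fun x =>
    hθ.smooth.continuous.deriv_integral _ 0 x
  have h3 : ∫ x in Ioo 0 L, (0 : L2 L) x * ∫ t in (0 : ℝ)..x, (φ t - d * η t) = 0 := by
    refine integral_eq_zero_of_ae ?_
    filter_upwards [Lp.coeFn_zero ℝ 2 (volume.restrict (Ioo (0 : ℝ) L))] with x hx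
    rw [hx, Pi.zero_apply, zero_mul]
  simp only [h2] at h1
  rw [h3, neg_zero] at h1
  have h4 : ∫ x in Ioo 0 L, u x * φ x = c * d := by
    have : ∀ x, u x * (φ x - d * η x) = u x * φ x - d * (u x * η x) := fun x => by ring
    simp only [this] at h1
    rw [integral_sub (hφ.integrable u) ((hη.integrable u).const_mul d), integral_const_mul] at h1
    linarith
  rw [hasWeakDeriv_antideriv hL u φ hφ, h4, hd, ← integral_const_mul]
  congr 1
  refine integral_congr_ae ?_
  filter_upwards [coeFn_ofCont hL (BoundedContinuousFunction.const _ c)] with x hx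
  rw [hx]
  rfl

open scoped ENNReal

/-! ### Clamped functions as second primitives -/

/-- The conditions at `L` on `g` that make `antideriv hL (antideriv hL g)` clamped. -/
def endConditions (hL : 0 < L) : L2 L →L[ℝ] ℝ × ℝ :=
  let ev := evalCLM (β := ℝ) ℝ (⟨L, right_mem_Icc.2 hL.le⟩ : Icc 0 L)
  (ev ∘L primitive hL).prod (ev ∘L primitive hL ∘L antideriv hL)

theorem endConditions_eq_zero {hL : 0 < L} {g : L2 L} :
    endConditions hL g = 0 ↔
      ∫ t in (0 : ℝ)..L, g t = 0 ∧ ∫ t in (0 : ℝ)..L, antideriv hL g t = 0 :=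
  Prod.ext_iff

theorem IsClamped.eq_antideriv (hL : 0 < L) {w : ℝ → ℝ} (hw : IsClamped L w) :
    ∃ f : Icc 0 L →ᵇ ℝ, f ⟨0, left_mem_Icc.2 hL.le⟩ = 0 ∧ f ⟨L, right_mem_Icc.2 hL.le⟩ = 0 ∧
      ∀ x ∈ Icc 0 L, ∫ t in (0 : ℝ)..x, ofCont hL f t = w x := by
  have hc : ContinuousOn (derivWithin w (Icc 0 L)) (Icc 0 L) :=
    hw.contDiffOn.continuousOn_derivWithin (uniqueDiffOn_Icc hL) le_rfl
  have hc' : Continuous fun x : Icc 0 L => derivWithin w (Icc 0 L) x := hc.domRestrict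
  refine ⟨mkOfCompact ⟨_, hc'⟩, hw.deriv_left, hw.deriv_right, fun x hx => ?_⟩
  have h0 := left_mem_Icc.2 hL.le
  have h1 : ofCont hL (mkOfCompact ⟨_, hc'⟩) =ᵐ[volume.restrict (Ioo 0 L)]
      derivWithin w (Icc 0 L) := by
    refine (coeFn_ofCont hL _).trans ?_
    refine (ae_restrict_iff' measurableSet_Ioo).2 (Filter.Eventually.of_forall fun x hx => ?_)
    exact IccExtend_of_mem hL.le _ (Ioo_subset_Icc_self hx)
  have hsub : Icc 0 x ⊆ Icc 0 L := Icc_subset_Icc_right hx.2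
  rw [intervalIntegral_congr_ae_Ioo h1 h0 hx,
    intervalIntegral.integral_eq_sub_of_hasDerivAt_of_le hx.1
      (hw.contDiffOn.continuousOn.mono hsub) (fun y hy => ?_)
      (hc.mono ((uIcc_of_le hx.1).trans_subset hsub)).intervalIntegrable, hw.left, sub_zero]
  have hy' : Icc 0 L ∈ nhds y := Icc_mem_nhds hy.1 (hy.2.trans_le hx.2)
  exact ((hw.contDiffOn.differentiableOn (by simp)) y (mem_of_mem_nhds hy')).hasDerivWithinAt
    |>.hasDerivAt hy'

/-- Here `g = u''`. The difference of `w'` and the primitive of `g` has zero weak derivative, so it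
is constant, and `w'(0) = 0` makes it vanish. -/
theorem mem_H20_iff (hL : 0 < L) {u : L2 L} :
    u ∈ H20 L ↔ ∃ g, endConditions hL g = 0 ∧ u = antideriv hL (antideriv hL g) := by
  have h0 := left_mem_Icc.2 hL.le
  have h0L := right_mem_Icc.2 hL.le
  constructor
  · rintro ⟨⟨g₁, g, hg₁, hg⟩, w, hw, huw⟩
    obtain ⟨f, hf0, hfL, hfw⟩ := hw.eq_antideriv hL
    have hu : u = antideriv hL (ofCont hL f) := by
      refine Lp.ext (huw.trans (Filter.EventuallyEq.trans ?_ (coeFn_antideriv hL _).symm))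
      refine (ae_restrict_iff' measurableSet_Ioo).2 (Filter.Eventually.of_forall fun x hx => ?_)
      exact (hfw x (Ioo_subset_Icc_self hx)).symm
    have hg₁f : g₁ = ofCont hL f := hg₁.unique (hu ▸ hasWeakDeriv_antideriv hL _)
    have hz : HasWeakDeriv L (ofCont hL f + (-1 : ℝ) • antideriv hL g) 0 := by
      have := (hg₁f ▸ hg).add ((hasWeakDeriv_antideriv hL g).smul (-1))
      simpa using this
    obtain ⟨c, hc⟩ := hz.eq_const hL
    have hfc : f = primitive hL g + BoundedContinuousFunction.const _ c := by
      refine ofCont_injective hL ?_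
      rw [map_add, ← hc]
      change _ = antideriv hL g + _
      simp
    have hc0 : c = 0 := by
      have := DFunLike.congr_fun hfc ⟨0, h0⟩
      rw [hf0, BoundedContinuousFunction.add_apply, primitive_apply] at this
      simpa using this.symm
    have hfp : f = primitive hL g := by
      rw [hfc, hc0]
      ext
      simp
    have hfg : ofCont hL f = antideriv hL g := by rw [hfp]; rfl
    refine ⟨g, endConditions_eq_zero.2 ⟨?_, ?_⟩, by rw [hu, hfg]⟩
    · rw [hfp] at hfL
      exact hfL
    · rw [← hfg, hfw L h0L, hw.right]
  · rintro ⟨g, hg, rfl⟩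
    rw [endConditions_eq_zero] at hg
    refine ⟨⟨_, _, hasWeakDeriv_antideriv hL _, hasWeakDeriv_antideriv hL _⟩, ?_⟩
    -- Extending the integrand constantly outside `[0, L]` makes `w` continuously differentiable on
    -- `ℝ`, so its one-sided derivatives at the ends are ordinary ones.
    have hcont : Continuous (IccExtend hL.le (primitive hL g)) :=
      (primitive hL g).continuous.Icc_extend'
    set w : ℝ → ℝ := fun x => ∫ t in (0 : ℝ)..x, IccExtend hL.le (primitive hL g) t with hw
    have hd : ∀ x, HasDerivAt w (IccExtend hL.le (primitive hL g) x) x := fun x =>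
      intervalIntegral.integral_hasDerivAt_right (hcont.intervalIntegrable _ _)
        (hcont.stronglyMeasurableAtFilter _ _) hcont.continuousAt
    have hJ : ∀ x ∈ Icc 0 L, ∫ t in (0 : ℝ)..x, antideriv hL g t = w x := fun x hx =>
      intervalIntegral_congr_ae_Ioo (coeFn_ofCont hL _) h0 hx
    refine ⟨w, ⟨ContDiff.contDiffOn ?_, by simp [hw], ?_, ?_, ?_⟩, ?_⟩
    · rw [contDiff_one_iff_deriv]
      refine ⟨fun x => (hd x).differentiableAt, ?_⟩
      rwa [funext fun x => (hd x).deriv]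
    · rw [← hJ L h0L, hg.2]
    · rw [(hd 0).hasDerivWithinAt.derivWithin (uniqueDiffOn_Icc hL 0 h0),
        IccExtend_of_mem _ _ h0]
      exact intervalIntegral.integral_same
    · rw [(hd L).hasDerivWithinAt.derivWithin (uniqueDiffOn_Icc hL L h0L),
        IccExtend_of_mem _ _ h0L]
      exact hg.1
    · refine (coeFn_antideriv hL _).trans ?_
      refine (ae_restrict_iff' measurableSet_Ioo).2 (Filter.Eventually.of_forall fun x hx => ?_)
      exact hJ x (Ioo_subset_Icc_self hx)

theorem weakDeriv_antideriv (hL : 0 < L) (g : L2 L) : weakDeriv L (antideriv hL g) = g :=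
  (hasWeakDeriv_antideriv hL g).weakDeriv_eq

theorem geometricForm_antideriv (hL : 0 < L) (g h : L2 L) :
    geometricForm L (antideriv hL g) (antideriv hL h) = inner ℝ g h := by
  rw [geometricForm, weakDeriv_antideriv, weakDeriv_antideriv, L2.inner_def]
  exact integral_congr_ae (Filter.Eventually.of_forall fun x => mul_comm _ _)

/-! ### The Hilbert space of bending moments -/

/-- Multiplication of square integrable functions by a bounded measurable function. -/
def mulBounded {q : ℝ → ℝ} (hq : MemLp q ∞ (volume.restrict (Ioo 0 L))) : L2 L →L[ℝ] L2 L :=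
  (ContinuousLinearMap.mul ℝ ℝ).holderL (volume.restrict (Ioo 0 L)) ∞ 2 2 (hq.toLp q)

theorem coeFn_mulBounded {q : ℝ → ℝ} (hq : MemLp q ∞ (volume.restrict (Ioo 0 L))) (g : L2 L) :
    mulBounded hq g =ᵐ[volume.restrict (Ioo 0 L)] fun x => q x * g x := by
  refine ((ContinuousLinearMap.mul ℝ ℝ).coeFn_holder (r := 2) (hq.toLp q) g).trans ?_
  filter_upwards [hq.coeFn_toLp] with x hx
  rw [hx, ContinuousLinearMap.mul_apply']

/-- `k` is measurable on `(0, L)` with positive lower and upper bounds. -/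
structure IsStiffness (L : ℝ) (k : ℝ → ℝ) : Prop where
  aemeasurable : AEMeasurable k (volume.restrict (Ioo 0 L))
  exists_bounds : ∃ c C, 0 < c ∧ ∀ t ∈ Ioo 0 L, c ≤ k t ∧ k t ≤ C

namespace IsStiffness

variable {k : ℝ → ℝ}

theorem pos (hk : IsStiffness L k) {t : ℝ} (ht : t ∈ Ioo 0 L) : 0 < k t := by
  obtain ⟨c, C, hc, h⟩ := hk.exists_bounds
  exact hc.trans_le (h t ht).1

theorem memLp_sqrt (hk : IsStiffness L k) :
    MemLp (fun t => √(k t)) ∞ (volume.restrict (Ioo 0 L)) := by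
  obtain ⟨c, C, hc, h⟩ := hk.exists_bounds
  refine memLp_top_of_bound hk.aemeasurable.sqrt.aestronglyMeasurable √C
    ((ae_restrict_iff' measurableSet_Ioo).2 (Filter.Eventually.of_forall fun t ht => ?_))
  rw [Real.norm_of_nonneg (Real.sqrt_nonneg _)]
  exact Real.sqrt_le_sqrt (h t ht).2

theorem memLp_inv_sqrt (hk : IsStiffness L k) :
    MemLp (fun t => (√(k t))⁻¹) ∞ (volume.restrict (Ioo 0 L)) := by
  obtain ⟨c, C, hc, h⟩ := hk.exists_bounds
  refine memLp_top_of_bound hk.aemeasurable.sqrt.inv.aestronglyMeasurable (√c)⁻¹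
    ((ae_restrict_iff' measurableSet_Ioo).2 (Filter.Eventually.of_forall fun t ht => ?_))
  rw [Real.norm_of_nonneg (by positivity)]
  exact inv_anti₀ (Real.sqrt_pos.2 hc) (Real.sqrt_le_sqrt (h t ht).1)

/-- Multiplication by `√k`. -/
def mulSqrt (hk : IsStiffness L k) : L2 L →L[ℝ] L2 L := mulBounded hk.memLp_sqrt

/-- Division by `√k`. -/
def divSqrt (hk : IsStiffness L k) : L2 L →L[ℝ] L2 L := mulBounded hk.memLp_inv_sqrt

theorem divSqrt_mulSqrt (hk : IsStiffness L k) (g : L2 L) : hk.divSqrt (hk.mulSqrt g) = g := by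
  refine Lp.ext ?_
  filter_upwards [coeFn_mulBounded hk.memLp_inv_sqrt (hk.mulSqrt g),
    coeFn_mulBounded hk.memLp_sqrt g, ae_restrict_mem measurableSet_Ioo] with t h1 h2 ht
  have := (Real.sqrt_pos.2 (hk.pos ht)).ne'
  rw [divSqrt, h1, mulSqrt, h2, inv_mul_cancel_left₀ this]

theorem mulSqrt_divSqrt (hk : IsStiffness L k) (g : L2 L) : hk.mulSqrt (hk.divSqrt g) = g := by
  refine Lp.ext ?_
  filter_upwards [coeFn_mulBounded hk.memLp_sqrt (hk.divSqrt g),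
    coeFn_mulBounded hk.memLp_inv_sqrt g, ae_restrict_mem measurableSet_Ioo] with t h1 h2 ht
  have := (Real.sqrt_pos.2 (hk.pos ht)).ne'
  rw [mulSqrt, h1, divSqrt, h2, mul_inv_cancel_left₀ this]

theorem integral_divSqrt (hk : IsStiffness L k) (f g : L2 L) :
    ∫ x in Ioo 0 L, k x * hk.divSqrt f x * hk.divSqrt g x = inner ℝ f g := by
  rw [L2.inner_def]
  refine integral_congr_ae ?_
  filter_upwards [coeFn_mulBounded hk.memLp_inv_sqrt f, coeFn_mulBounded hk.memLp_inv_sqrt g,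
    ae_restrict_mem measurableSet_Ioo] with t h1 h2 ht
  have h3 := (Real.sqrt_pos.2 (hk.pos ht)).ne'
  have h4 := Real.mul_self_sqrt (hk.pos ht).le
  rw [divSqrt, h1, h2]
  change _ = g t * f t
  nth_rewrite 1 [← h4]
  field_simp

/-- The functions `√k u''` for `u ∈ H²₀(0, L)`. -/
def momentSpace (hL : 0 < L) (hk : IsStiffness L k) : Submodule ℝ (L2 L) :=
  LinearMap.ker (endConditions hL ∘L hk.divSqrt).toLinearMap

theorem mem_momentSpace {hL : 0 < L} {hk : IsStiffness L k} {f : L2 L} :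
    f ∈ hk.momentSpace hL ↔ endConditions hL (hk.divSqrt f) = 0 := Iff.rfl

instance (hL : 0 < L) (hk : IsStiffness L k) : CompleteSpace (hk.momentSpace hL) :=
  (endConditions hL ∘L hk.divSqrt).isClosed_ker.completeSpace_coe

/-- The map `√k u'' ↦ u'`. -/
def slope (hL : 0 < L) (hk : IsStiffness L k) : hk.momentSpace hL →L[ℝ] L2 L :=
  antideriv hL ∘L hk.divSqrt ∘L (hk.momentSpace hL).subtypeL

theorem slope_apply (hL : 0 < L) (hk : IsStiffness L k) (f : hk.momentSpace hL) :
    hk.slope hL f = antideriv hL (hk.divSqrt f) := rfl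

theorem isCompactOperator_slope (hL : 0 < L) (hk : IsStiffness L k) :
    IsCompactOperator (hk.slope hL) :=
  (isCompactOperator_antideriv hL).comp_clm (hk.divSqrt ∘L (hk.momentSpace hL).subtypeL)

theorem slope_injective (hL : 0 < L) (hk : IsStiffness L k) :
    Function.Injective (hk.slope hL) :=
  (antideriv_injective hL).comp
    ((Function.LeftInverse.injective hk.mulSqrt_divSqrt).comp Subtype.val_injective)

/-- The map `√k u'' ↦ u`. -/
def deflection (hL : 0 < L) (hk : IsStiffness L k) : hk.momentSpace hL →ₗ[ℝ] L2 L :=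
  (antideriv hL ∘L hk.slope hL).toLinearMap

theorem deflection_apply (hL : 0 < L) (hk : IsStiffness L k) (f : hk.momentSpace hL) :
    hk.deflection hL f = antideriv hL (hk.slope hL f) := rfl

theorem deflection_injective (hL : 0 < L) (hk : IsStiffness L k) :
    Function.Injective (hk.deflection hL) :=
  (antideriv_injective hL).comp (hk.slope_injective hL)

theorem mem_H20_iff_exists_deflection (hL : 0 < L) (hk : IsStiffness L k) {u : L2 L} :
    u ∈ H20 L ↔ ∃ f, u = hk.deflection hL f := by
  rw [mem_H20_iff hL]
  constructor
  · rintro ⟨g, hg, rfl⟩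
    refine ⟨⟨hk.mulSqrt g, mem_momentSpace.2 (by rwa [hk.divSqrt_mulSqrt])⟩, ?_⟩
    rw [deflection_apply, slope_apply, hk.divSqrt_mulSqrt]
  · rintro ⟨f, rfl⟩
    exact ⟨hk.divSqrt f, f.2, rfl⟩

theorem bendingForm_deflection (hL : 0 < L) (hk : IsStiffness L k) (f g : hk.momentSpace hL) :
    bendingForm L k (hk.deflection hL f) (hk.deflection hL g) = inner ℝ f g := by
  simp only [bendingForm, deflection_apply, slope_apply, weakDeriv_antideriv]
  exact hk.integral_divSqrt f g

theorem isEigenfunction_deflection (hL : 0 < L) (hk : IsStiffness L k) {r : ℝ}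
    {f : hk.momentSpace hL} :
    IsEigenfunction L k r (hk.deflection hL f) ↔ f ≠ 0 ∧ f ∈ pencilSpace (hk.slope hL) r := by
  have hne : hk.deflection hL f ≠ 0 ↔ f ≠ 0 := (hk.deflection hL).map_eq_zero_iff
    (hk.deflection_injective hL) |>.not
  have hform : ∀ g, (bendingForm L k (hk.deflection hL f) (hk.deflection hL g) =
      r * geometricForm L (hk.deflection hL f) (hk.deflection hL g)) ↔
      inner ℝ f g = r * inner ℝ (hk.slope hL f) (hk.slope hL g) := fun g => by
    rw [hk.bendingForm_deflection, deflection_apply, deflection_apply, geometricForm_antideriv]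
  rw [mem_pencilSpace]
  constructor
  · intro h
    exact ⟨hne.1 h.ne_zero, fun g => (hform g).1
      (h.weak_form _ ((hk.mem_H20_iff_exists_deflection hL).2 ⟨g, rfl⟩))⟩
  · rintro ⟨h, h'⟩
    refine ⟨(hk.mem_H20_iff_exists_deflection hL).2 ⟨f, rfl⟩, hne.2 h, fun v hv => ?_⟩
    obtain ⟨g, rfl⟩ := (hk.mem_H20_iff_exists_deflection hL).1 hv
    exact (hform g).2 (h' g)

theorem eigenspace_eq_map (hL : 0 < L) (hk : IsStiffness L k) (r : ℝ) :
    eigenspace L k r = (pencilSpace (hk.slope hL) r).map (hk.deflection hL) := by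
  refine le_antisymm (Submodule.span_le.2 fun u hu => ?_) ?_
  · obtain ⟨f, rfl⟩ := (hk.mem_H20_iff_exists_deflection hL).1 hu.mem
    exact ⟨f, ((hk.isEigenfunction_deflection hL).1 hu).2, rfl⟩
  · rintro _ ⟨f, hf, rfl⟩
    by_cases h : f = 0
    · simp [h]
    · exact Submodule.subset_span ((hk.isEigenfunction_deflection hL).2 ⟨h, hf⟩)

theorem isEigenvalueSequence_iff (hL : 0 < L) (hk : IsStiffness L k) {P : ℕ → ℝ} :
    IsEigenvalueSequence L k P ↔ IsPencilSequence (hk.slope hL) P := by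
  have h : ∀ r, Module.rank ℝ (eigenspace L k r) =
      Module.rank ℝ (pencilSpace (hk.slope hL) r) := fun r => by
    rw [hk.eigenspace_eq_map hL]
    exact (Submodule.equivMapOfInjective _ (hk.deflection_injective hL) _).rank_eq.symm
  exact ⟨fun hP => ⟨hP.mono, fun r => by rw [hP.multiplicity, h]⟩,
    fun hP => ⟨hP.mono, fun r => by rw [hP.multiplicity, h]⟩⟩

end IsStiffness

/-! ### Existence of the eigenvalue sequences and monotonicity in the stiffness. -/

theorem not_finiteDimensional_L2 (hL : 0 < L) : ¬ FiniteDimensional ℝ (L2 L) := by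
  intro h
  -- Polynomials embed linearly in L² through continuous functions.
  refine Polynomial.not_finite (R := ℝ) (Module.Finite.of_injective
    ((ofCont hL).toLinearMap ∘ₗ
      (ContinuousMap.linearIsometryBoundedOfCompact (Icc 0 L) ℝ ℝ).toLinearEquiv.toLinearMap ∘ₗ
      (Polynomial.toContinuousMapOnAlgHom (Icc 0 L)).toLinearMap) ?_)
  refine (ofCont_injective hL).comp ((LinearIsometryEquiv.injective
    (ContinuousMap.linearIsometryBoundedOfCompact (Icc 0 L) ℝ ℝ)).comp fun p q hpq => ?_)
  exact Polynomial.eq_of_infinite_eval_eq p q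
    ((Icc_infinite hL).mono fun x hx => DFunLike.congr_fun hpq (⟨x, hx⟩ : Icc 0 L))

namespace IsStiffness

variable {k κ : ℝ → ℝ}

theorem not_finiteDimensional_momentSpace (hL : 0 < L) (hk : IsStiffness L k) :
    ¬ FiniteDimensional ℝ (hk.momentSpace hL) := by
  intro h
  refine not_finiteDimensional_L2 hL ?_
  have : Module.Finite ℝ (L2 L ⧸ hk.momentSpace hL) :=
    Module.Finite.equiv (LinearMap.quotKerEquivRange
      (endConditions hL ∘L hk.divSqrt).toLinearMap).symm
  exact Module.Finite.of_submodule_quotient (hk.momentSpace hL)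

theorem exists_isEigenvalueSequence (hL : 0 < L) (hk : IsStiffness L k) :
    ∃ P, IsEigenvalueSequence L k P := by
  simp only [hk.isEigenvalueSequence_iff hL]
  exact exists_isPencilSequence (hk.isCompactOperator_slope hL) (hk.slope_injective hL)
    (hk.not_finiteDimensional_momentSpace hL)

theorem norm_mulSqrt_divSqrt_le (hk : IsStiffness L k) (hκ : IsStiffness L κ)
    (hle : ∀ t ∈ Ioo 0 L, κ t ≤ k t) (f : L2 L) : ‖hκ.mulSqrt (hk.divSqrt f)‖ ≤ ‖f‖ := by
  refine Lp.norm_le_norm_of_ae_le ?_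
  filter_upwards [coeFn_mulBounded hκ.memLp_sqrt (hk.divSqrt f),
    coeFn_mulBounded hk.memLp_inv_sqrt f, ae_restrict_mem measurableSet_Ioo] with t h1 h2 ht
  rw [mulSqrt, h1, divSqrt, h2, ← mul_assoc, norm_mul, ← div_eq_mul_inv,
    Real.norm_of_nonneg (by positivity)]
  exact mul_le_of_le_one_left (norm_nonneg _)
    (div_le_one_of_le₀ (Real.sqrt_le_sqrt (hle t ht)) (Real.sqrt_nonneg _))

/-- The eigenvalues of the buckling problem are monotone in the bending stiffness. -/
theorem eigenvalue_le (hL : 0 < L) (hk : IsStiffness L k) (hκ : IsStiffness L κ)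
    (hle : ∀ t ∈ Ioo 0 L, κ t ≤ k t) {P P' : ℕ → ℝ} (hP : IsEigenvalueSequence L k P)
    (hP' : IsEigenvalueSequence L κ P') (i : ℕ) : P' i ≤ P i := by
  rw [hk.isEigenvalueSequence_iff hL] at hP
  rw [hκ.isEigenvalueSequence_iff hL] at hP'
  -- `S` sends `√k u''` to `√κ u''`. It leaves `u''` unchanged, so the end conditions and the slope
  -- are preserved.
  let S : hk.momentSpace hL →ₗ[ℝ] hκ.momentSpace hL :=
    ((hκ.mulSqrt ∘L hk.divSqrt).toLinearMap ∘ₗ (hk.momentSpace hL).subtype).codRestrict _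
      fun f => mem_momentSpace.2 ((congrArg _ (hκ.divSqrt_mulSqrt _)).trans f.2)
  refine hP.le_of_norm_le (hk.isCompactOperator_slope hL) (hk.slope_injective hL)
    (hκ.isCompactOperator_slope hL) (hκ.slope_injective hL) hP' S
    (fun f => norm_mulSqrt_divSqrt_le hk hκ hle f) (fun f => ?_) i
  rw [slope_apply, slope_apply]
  exact congrArg (fun g => ‖antideriv hL g‖) (hκ.divSqrt_mulSqrt _)

end IsStiffness

/-! ### Piecewise constant stiffness -/

theorem exists_piecewiseMin_eq {N : ℕ} {x : Fin (N + 1) → ℝ} (hx : StrictMono x) (k : ℝ → ℝ)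
    {t : ℝ} (h0 : x 0 ≤ t) (ht : t < x (Fin.last N)) :
    ∃ j : Fin N, t ∈ Ico (x j.castSucc) (x j.succ) ∧ piecewiseMin x k t = elementMin x k j := by
  classical
  -- The left node of the element containing `t` is the last node not exceeding `t`.
  obtain ⟨m, hm, hmax⟩ := (Finset.univ.filter fun j => x j ≤ t).exists_maximal
    ⟨0, by simpa using h0⟩
  simp only [Finset.mem_filter, Finset.mem_univ, true_and] at hm hmax
  have hlast : m ≠ Fin.last N := by
    rintro rfl
    exact absurd hm (not_le.2 ht)
  obtain ⟨j, rfl⟩ := Fin.exists_castSucc_eq.2 hlast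
  have hj : t < x j.succ := by
    by_contra! h
    exact absurd (hmax h (Fin.castSucc_lt_succ).le) (not_le.2 Fin.castSucc_lt_succ)
  refine ⟨j, ⟨hm, hj⟩, ?_⟩
  rw [piecewiseMin, Finset.sum_eq_single_of_mem j (Finset.mem_univ j), indicator_of_mem]
  · exact ⟨hm, hj⟩
  · refine fun i _ hij => indicator_of_notMem (fun hi => ?_) _
    rcases lt_or_gt_of_ne hij with h | h
    · exact absurd (hi.2.trans_le (hx.monotone (Fin.succ_le_castSucc_iff.2 h))) (not_lt.2 hm)
    · exact absurd (hj.trans_le (hx.monotone (Fin.succ_le_castSucc_iff.2 h))) (not_lt.2 hi.1)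

theorem elementMin_le {N : ℕ} (x : Fin (N + 1) → ℝ) {k : ℝ → ℝ} {c : ℝ} {j : Fin N}
    (hk : ∀ t ∈ Icc (x j.castSucc) (x j.succ), c ≤ k t) {t : ℝ}
    (ht : t ∈ Icc (x j.castSucc) (x j.succ)) : elementMin x k j ≤ k t := by
  refine csInf_le ⟨c, ?_⟩ (mem_image_of_mem k ht)
  rintro _ ⟨s, hs, rfl⟩
  exact hk s hs

theorem le_elementMin {N : ℕ} {x : Fin (N + 1) → ℝ} (hx : StrictMono x) {k : ℝ → ℝ} {c : ℝ}
    {j : Fin N} (hk : ∀ t ∈ Icc (x j.castSucc) (x j.succ), c ≤ k t) : c ≤ elementMin x k j := by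
  refine le_csInf ((nonempty_Icc.2 (hx Fin.castSucc_lt_succ).le).image k) ?_
  rintro _ ⟨s, hs, rfl⟩
  exact hk s hs

theorem measurable_piecewiseMin {N : ℕ} (x : Fin (N + 1) → ℝ) (k : ℝ → ℝ) :
    Measurable (piecewiseMin x k) :=
  Finset.measurable_sum _ fun _ _ => measurable_const.indicator measurableSet_Ico

end Beam

end

theorem mainTheorem4 (L : ℝ) (hL : 0 < L) (E I : ℝ → ℝ)
    (hE : ∀ t ∈ Set.Icc 0 L, 0 < E t) (hI : ∀ t ∈ Set.Icc 0 L, 0 < I t)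
    (hmeas : AEMeasurable (fun t => E t * I t)
      (MeasureTheory.volume.restrict (Set.Ioo 0 L)))
    (C₁ C₂ : ℝ) (hC₁ : 0 < C₁)
    (hbound : ∀ t ∈ Set.Ioo 0 L, C₁ ≤ E t * I t ∧ E t * I t ≤ C₂)
    (N : ℕ) (x : Fin (N + 1) → ℝ) (hx : StrictMono x)
    (hx0 : x 0 = 0) (hxL : x (Fin.last N) = L) :
    (∃ P : ℕ → ℝ, Beam.IsEigenvalueSequence L (fun t => E t * I t) P) ∧
    (∃ P' : ℕ → ℝ,
      Beam.IsEigenvalueSequence L (Beam.piecewiseMin x (fun t => E t * I t)) P') ∧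
    ∀ P P' : ℕ → ℝ,
      Beam.IsEigenvalueSequence L (fun t => E t * I t) P →
      Beam.IsEigenvalueSequence L (Beam.piecewiseMin x (fun t => E t * I t)) P' →
      ∀ i : ℕ, P' i ≤ P i := by
  set k : ℝ → ℝ := fun t => E t * I t with hkdef
  have h0 := left_mem_Icc.2 hL.le
  have hLm := right_mem_Icc.2 hL.le
  obtain ⟨c, hc, hck⟩ : ∃ c > 0, ∀ t ∈ Icc 0 L, c ≤ k t := by
    -- The bounds hold only on the open interval, whereas the infima over the end elements also see
    -- `k 0` and `k L`. These are positive, so they are included in the minimum.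
    refine ⟨min C₁ (min (k 0) (k L)), lt_min hC₁ (lt_min (mul_pos (hE 0 h0) (hI 0 h0))
      (mul_pos (hE L hLm) (hI L hLm))), fun t ht => ?_⟩
    rcases eq_endpoints_or_mem_Ioo_of_mem_Icc ht with rfl | rfl | h
    · exact (min_le_right _ _).trans (min_le_left _ _)
    · exact (min_le_right _ _).trans (min_le_right _ _)
    · exact (min_le_left _ _).trans (hbound t h).1
  have hck' : ∀ j : Fin N, ∀ t ∈ Icc (x j.castSucc) (x j.succ), c ≤ k t := fun j t ht =>
    hck t ⟨hx0 ▸ (hx.monotone (Fin.zero_le _)).trans ht.1,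
      hxL ▸ ht.2.trans (hx.monotone (Fin.le_last _))⟩
  have hκ : ∀ t ∈ Ioo 0 L, c ≤ Beam.piecewiseMin x k t ∧ Beam.piecewiseMin x k t ≤ k t := by
    intro t ht
    obtain ⟨j, hj, he⟩ := Beam.exists_piecewiseMin_eq hx k (hx0 ▸ ht.1.le) (hxL ▸ ht.2)
    rw [he]
    exact ⟨Beam.le_elementMin hx (hck' j),
      Beam.elementMin_le x (hck' j) (Ico_subset_Icc_self hj)⟩
  have hk : Beam.IsStiffness L k := ⟨hmeas, C₁, C₂, hC₁, hbound⟩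
  have hk' : Beam.IsStiffness L (Beam.piecewiseMin x k) :=
    ⟨(Beam.measurable_piecewiseMin x k).aemeasurable, c, C₂, hc, fun t ht =>
      ⟨(hκ t ht).1, (hκ t ht).2.trans (hbound t ht).2⟩⟩
  exact ⟨hk.exists_isEigenvalueSequence hL, hk'.exists_isEigenvalueSequence hL,
    fun _ _ hP hP' => hk.eigenvalue_le hL hk' (fun t ht => (hκ t ht).2) hP hP'⟩
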